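/- Let $N$ be a von Neumann algebra with separable predual $N_*$, equipped with a faithful normal tracial state $\tau$ (so $N$ is finite), and write $\|x\|_2=\tau(x^*x)^{1/2}$. Let $\operatorname{SA}(N)$ be the set of all von Neumann subalgebras of $N$ with the same unit as $N$. A subalgebra $M\in\operatorname{SA}(N)$ has the Haagerup property if there is a sequence $(\varphi_n)$ of normal completely positive maps $\varphi_n:M\to M$ such that $\varphi_n(1)\le 1$ and $\tau\circ\varphi_n\le\tau$ on $M_+$ for every $n$, the extension of each $\varphi_n$ to a bounded operator on $L^2(M,\tau)$ is compact, and $\lim_n\|\varphi_n(x)-x\|_2=0$ for every $x\in M$. Let $\operatorname{HAP}(N)\subset\operatorname{SA}(N)$ be the set of all von Neumann subalgebras with the Haagerup property. For a net $(M_i)_{i\in I}$ in $\operatorname{SA}(N)$, let $\liminf_i M_i$ be the set of all $x\in N$ for which there is a norm-bounded net $(x_i)_{i\in I}$ with $x_i\in M_i$ and $\lim_i\|x_i-x\|_2=0$, and let $\limsup_i M_i$ be the von Neumann subalgebra generated by all limit points, in the weak operator topology, of norm-bounded nets $(x_i)_{i\in I}$ with $x_i\in M_i$. The Effros–Maréchal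 topology on $\operatorname{SA}(N)$ is the coarsest topology for which $M\mapsto\|\omega|_M\|$ is continuous for every $\omega\in N_*$; for it, a net $(M_i)$ converges to $M$ if and only if $\liminf_i M_i=\limsup_i M_i=M$. Proposition. If $(M_i)_{i\in I}$ is a net in $\operatorname{HAP}(N)$ and $M\in\operatorname{SA}(N)$ satisfies $M=\liminf_i M_i$, then $M\in\operatorname{HAP}(N)$. In particular: (1) $\operatorname{HAP}(N)$ is closed in $\operatorname{SA}(N)$ with respect to the Effros–Maréchal topology; also, if a net $(M_i)$ in $\operatorname{HAP}(N)$ and $M\in\operatorname{SA}(N)$ satisfy $\liminf_i M_i=\limsup_i M_i=M$, then $M\in\operatorname{HAP}(N)$. (2) For every $P\in\operatorname{HAP}(N)$ there is a maximal element $Q$ of $\operatorname{HAP}(N)$ (with respect to inclusion) such that $P\subset Q$. -/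

import Mathlib

open Filter Topology
open scoped ComplexOrder CStarAlgebra

namespace HaagerupMax

section Algebra

variable {H : Type*} [NormedAddCommGroup H] [InnerProductSpace ℂ H] [CompleteSpace H]

/-! ### A von Neumann algebra as an ordered C⋆-algebra -/

instance instSMulMemClass : SMulMemClass (VonNeumannAlgebra H) ℂ (H →L[ℂ] H) where
  smul_mem {s} c _ hx := s.toStarSubalgebra.smul_mem hx c

theorem isClosed_coe (M : VonNeumannAlgebra H) : IsClosed (M : Set (H →L[ℂ] H)) := by
  rw [← M.centralizer_centralizer]
  exact Set.isClosed_centralizer _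

noncomputable instance instCStarAlgebra (M : VonNeumannAlgebra H) : CStarAlgebra M :=
  StarSubalgebra.cstarAlgebra M (h_closed := isClosed_coe M)

/-- The order of `M` is the Loewner order of `B(H)`, restricted to `M`; an element of `M` is
positive for it if and only if it is of the form `star s * s` with `s` in `M`. -/
instance instStarOrderedRing (M : VonNeumannAlgebra H) : StarOrderedRing M := by
  refine StarOrderedRing.of_nonneg_iff' (fun {x y} hxy z => ?_) (fun x => ⟨fun hx => ?_, ?_⟩)
  · exact add_le_add_right (show (x : H →L[ℂ] H) ≤ y from hxy) (z : H →L[ℂ] H)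
  · have hx' : (0 : H →L[ℂ] H) ≤ x := hx
    have hs : IsSelfAdjoint (CFC.sqrt (x : H →L[ℂ] H)) :=
      IsSelfAdjoint.of_nonneg (CFC.sqrt_nonneg _)
    have hmem : CFC.sqrt (x : H →L[ℂ] H) ∈ M := by
      rw [← SetLike.mem_coe, ← M.centralizer_centralizer, Set.mem_centralizer_iff]
      intro y hy
      have hc : Commute (x : H →L[ℂ] H) y := Set.mem_centralizer_iff.mp hy x x.2
      have := hc.cfc_nnreal NNReal.sqrt
      rw [← CFC.sqrt_eq_cfc] at this
      exact this.symm
    refine ⟨⟨_, hmem⟩, Subtype.ext ?_⟩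
    change (x : H →L[ℂ] H) = star (CFC.sqrt (x : H →L[ℂ] H)) * CFC.sqrt (x : H →L[ℂ] H)
    rw [hs.star_eq, CFC.sqrt_mul_sqrt_self _ hx']
  · rintro ⟨s, rfl⟩
    exact star_mul_self_nonneg (s : H →L[ℂ] H)

/-! ### Inclusions -/

/-- The inclusion `M ⊆ N`, as a bounded linear map. -/
noncomputable def inclCLM {M N : VonNeumannAlgebra H} (h : M ≤ N) : M →L[ℂ] N :=
  LinearMap.mkContinuous
    { toFun := fun x => ⟨(x : H →L[ℂ] H), h x.2⟩
      map_add' := fun _ _ => rfl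
      map_smul' := fun _ _ => rfl } 1 (fun x => by rw [one_mul]; exact le_of_eq rfl)

/-- The inclusion `M ⊆ N`, as a positive linear map. -/
noncomputable def inclPos {M N : VonNeumannAlgebra H} (h : M ≤ N) : M →ₚ[ℂ] N where
  toLinearMap := (inclCLM h).toLinearMap
  monotone' := fun _ _ hxy => hxy

/-- The restriction to `M` of a positive functional on `N`. -/
noncomputable def restrict {M N : VonNeumannAlgebra H} (h : M ≤ N) (τ : N →ₚ[ℂ] ℂ) :
    M →ₚ[ℂ] ℂ :=
  τ.comp (inclPos h)

/-! ### Normality and the predual -/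

/-- The inclusion of `M` into `B(H)` with the weak operator topology. -/
noncomputable def toWOT (M : VonNeumannAlgebra H) (x : M) : H →WOT[ℂ] H :=
  ContinuousLinearMapWOT.ofCLM (x : H →L[ℂ] H)

/-- The weak operator topology of `M`. -/
@[reducible] noncomputable def wot (M : VonNeumannAlgebra H) : TopologicalSpace M :=
  TopologicalSpace.induced (toWOT M) inferInstance

/-- A linear functional on a von Neumann algebra is normal (ultraweakly continuous) if its
restriction to the unit ball is continuous for the weak operator topology. -/
def IsNormalFunctional {M : VonNeumannAlgebra H} (ω : M →ₗ[ℂ] ℂ) : Prop :=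
  @ContinuousOn M ℂ (wot M) _ ω {x : M | ‖x‖ ≤ 1}

/-- A linear map is normal (ultraweakly continuous) if it pulls normal functionals back to
normal functionals. -/
def IsNormalMap {M N : VonNeumannAlgebra H} (φ : M →ₗ[ℂ] N) : Prop :=
  ∀ ω : N →ₗ[ℂ] ℂ, IsNormalFunctional ω → IsNormalFunctional (ω.comp φ)

/-- The predual of `M`: the space of normal functionals, as a subspace of the dual. -/
noncomputable def predual (M : VonNeumannAlgebra H) : Submodule ℂ (StrongDual ℂ M) where
  carrier := {ω | IsNormalFunctional ω.toLinearMap}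
  zero_mem' := by
    let _ := wot M
    exact continuousOn_const
  add_mem' := by
    intro a b ha hb
    let _ := wot M
    exact ContinuousOn.add ha hb
  smul_mem' := by
    intro c a ha
    let _ := wot M
    exact ContinuousOn.const_smul ha c

/-- The predual is separable for the norm topology. -/
def HasSeparablePredual (M : VonNeumannAlgebra H) : Prop :=
  TopologicalSpace.SeparableSpace (predual M)

/-! ### Traces and the Haagerup property -/

/-- `τ` is a faithful normal tracial state on `N`. -/
structure IsTrace (N : VonNeumannAlgebra H) (τ : N →ₚ[ℂ] ℂ) : Prop where
  map_one : τ 1 = 1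
  map_mul_comm : ∀ x y : N, τ (x * y) = τ (y * x)
  faithful : ∀ x : N, τ (star x * x) = 0 → x = 0
  normal : IsNormalFunctional τ.toLinearMap

/-- The norm `‖x‖₂ = τ(x⋆x)^{1/2}`. -/
noncomputable def norm2 {M : VonNeumannAlgebra H} (τ : M →ₚ[ℂ] ℂ) (x : M) : ℝ :=
  √(τ (star x * x)).re

/-- The canonical map `x ↦ x̂` from `M` to `L²(M, τ)`, the latter being the GNS Hilbert space. -/
noncomputable def hat {M : VonNeumannAlgebra H} (τ : M →ₚ[ℂ] ℂ) (x : M) : τ.GNS :=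
  ((τ.toPreGNS x : τ.PreGNS) : UniformSpace.Completion τ.PreGNS)

/-- The von Neumann algebra `M` with the trace `τ` has the Haagerup property: there are normal
completely positive maps `φₙ` on `M` with `φₙ(1) ≤ 1` and `τ ∘ φₙ ≤ τ`, whose extensions to
`L²(M, τ)` are compact, and with `‖φₙ(x) - x‖₂ → 0` for all `x`. -/
def HasHaagerupProperty (M : VonNeumannAlgebra H) (τ : M →ₚ[ℂ] ℂ) : Prop :=
  ∃ φ : ℕ → (M →CP M),
    (∀ n, IsNormalMap (φ n).toLinearMap) ∧
    (∀ n, φ n 1 ≤ 1) ∧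
    (∀ n, ∀ x : M, 0 ≤ x → τ (φ n x) ≤ τ x) ∧
    (∀ n, ∃ T : τ.GNS →L[ℂ] τ.GNS,
      (∀ x : M, T (hat τ x) = hat τ (φ n x)) ∧ IsCompactOperator T) ∧
    (∀ x : M, Tendsto (fun n => norm2 τ (φ n x - x)) atTop (𝓝 0))

/-! ### The space of von Neumann subalgebras -/

/-- The set of von Neumann subalgebras of `N` (with the same unit), ordered by inclusion. -/
abbrev SA (N : VonNeumannAlgebra H) : Type _ := {M : VonNeumannAlgebra H // M ≤ N}

/-- A von Neumann subalgebra of `N` as a set of elements of `N`. -/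
def SA.toSet {N : VonNeumannAlgebra H} (M : SA N) : Set N := {x | (x : H →L[ℂ] H) ∈ M.1}

/-- The set of von Neumann subalgebras of `N` which have the Haagerup property. -/
def HAP (N : VonNeumannAlgebra H) (τ : N →ₚ[ℂ] ℂ) : Set (SA N) :=
  {M | HasHaagerupProperty M.1 (restrict M.2 τ)}

/-- The Effros–Maréchal topology: the coarsest topology on the set of von Neumann subalgebras
of `N` for which all the functions `M ↦ ‖ω|_M‖`, with `ω` in the predual of `N`, are
continuous. -/
@[reducible] noncomputable def effrosMarechal (N : VonNeumannAlgebra H) : TopologicalSpace (SA N) :=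
  ⨅ ω : predual N, TopologicalSpace.induced
    (fun M : SA N => ‖(ω : StrongDual ℂ N).comp (inclCLM M.2)‖) inferInstance

/-- `y` is a bounded net with `y i ∈ M i`. -/
def IsBoundedSection {N : VonNeumannAlgebra H} {ι : Type*} (M : ι → SA N) (y : ι → N) : Prop :=
  (∀ i, y i ∈ (M i).toSet) ∧ ∃ C : ℝ, ∀ i, ‖y i‖ ≤ C

/-- The inferior limit of a net of von Neumann subalgebras: the set of all `‖·‖₂`-limits of
bounded nets `(y i)` with `y i ∈ M i`. -/
def emLiminf {N : VonNeumannAlgebra H} (τ : N →ₚ[ℂ] ℂ) {ι : Type*} [Preorder ι]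
    (M : ι → SA N) : Set N :=
  {x | ∃ y : ι → N, IsBoundedSection M y ∧ Tendsto (fun i => norm2 τ (y i - x)) atTop (𝓝 0)}

/-- The von Neumann subalgebra of `N` generated by `E`, as a set of elements of `N`: the
intersection of all von Neumann subalgebras of `N` which contain `E`. -/
def generated {N : VonNeumannAlgebra H} (E : Set N) : Set N :=
  {x | ∀ Q : SA N, E ⊆ Q.toSet → x ∈ Q.toSet}

/-- The superior limit of a net of von Neumann subalgebras: the von Neumann algebra generated by
all the limit points, in the weak operator topology, of bounded nets `(y i)` with `y i ∈ M i`. -/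
def emLimsup {N : VonNeumannAlgebra H} {ι : Type*} [Preorder ι] (M : ι → SA N) : Set N :=
  generated {x | ∃ y : ι → N, IsBoundedSection M y ∧
    MapClusterPt (toWOT N x) atTop (fun i => toWOT N (y i))}

end Algebra

end HaagerupMax

/-!
The approximating maps of a Haagerup subalgebra `P` are transported to `M` by means of the
trace-preserving conditional expectations `E_P : N → P` and `E_M : N → M`. If `φ` is one of the
maps which witness the Haagerup property of `P`, then `E_M ∘ φ ∘ E_P`, restricted to `M`, is a
normal completely positive map on `M` which is subunital and decreases the trace; its extension to
`L²(M)` is `V_M⋆ V_P T_φ V_P⋆ V_M`, with `V` the isometries induced by the inclusions into `N`,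
so that it is compact (`IsHaagerupMap.compress`). It moves `x` in `‖·‖₂` by at most
`‖φ(E_P x) - E_P x‖₂ + ‖E_P x - x‖₂`, where `E_P x` is the best approximation of `x` in `P`. By
the Kadison–Schwarz inequality the maps are `‖·‖₂`-contractions, and as the predual is separable,
`M` has a countable `‖·‖₂`-dense subset. Hence it is enough that each `x` in `M` can be approximated
in `‖·‖₂` by elements of Haagerup subalgebras `P` along some filter (`mem_HAP_of_approx`). For a net
with inferior limit `M` this is the definition.

For the Effros–Maréchal topology, one approximates the unitaries `u` of `M`, which span `M`:
`‖τ(· u⋆)|_M‖ = 1`, whereas `‖τ(· u⋆)|_P‖ ≤ ‖E_P u‖₂` and `‖E_P u - u‖₂² = 1 - ‖E_P u‖₂²`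
(`eventually_approx_unitary`).

For maximal elements, Zorn's lemma applies: a chain is bounded by the double commutant `Q` of its
union `A`, and the elements of `Q` are `‖·‖₂`-limits of elements of `A`
(`mem_approxSubmodule_of_isSelfAdjoint`). This is a weak form of the Kaplansky density theorem. It
follows from von Neumann's density theorem on finitely many vectors, applied to resolvents of
self-adjoint operators.

The existence of `E_P` is a Radon–Nikodym theorem (`IsTrace.exists_radonNikodym`), proved with the
Hahn–Banach theorem in `L²(P)` and the weak compactness of bounded sets
(`exists_wTendsto_of_ultrafilter`). Complete positivity of `E_P` is a consequence of its bimodule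
property, by the criterion `nonneg_of_sum_conj_nonneg` for the positivity of a matrix.
-/

namespace HaagerupMax

open scoped InnerProductSpace

/-! ### Positive matrices and completely positive maps -/

section CompletelyPositive

variable {A : Type*} [CStarAlgebra A] [PartialOrder A] [StarOrderedRing A]

/-- Stated separately so that it can be applied to `CStarMatrix`, where the instances for the
functional calculus are not found by instance resolution. -/
theorem exists_eq_star_mul_self {Y : A} (hY : 0 ≤ Y) : ∃ Z, Y = star Z * Z :=
  CStarAlgebra.nonneg_iff_eq_star_mul_self.mp hY

theorem sum_conj_nonneg_of_nonneg {k : ℕ} {Y : CStarMatrix (Fin k) (Fin k) A} (hY : 0 ≤ Y)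
    (a : Fin k → A) : 0 ≤ ∑ i, ∑ j, star (a i) * Y i j * a j := by
  obtain ⟨Z, rfl⟩ := exists_eq_star_mul_self hY
  have : ∑ i, ∑ j, star (a i) * (star Z * Z) i j * a j
      = ∑ l, star (∑ i, Z l i * a i) * (∑ j, Z l j * a j) := by
    simp only [CStarMatrix.mul_apply, CStarMatrix.star_apply, star_sum, star_mul,
      Finset.sum_mul, Finset.mul_sum]
    rw [Finset.sum_comm]
    refine (Finset.sum_congr rfl fun j _ => Finset.sum_comm).trans ?_
    rw [Finset.sum_comm]
    refine Finset.sum_congr rfl fun l _ => ?_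
    refine Finset.sum_congr rfl fun j _ => ?_
    refine Finset.sum_congr rfl fun i _ => ?_
    simp only [mul_assoc]
  rw [this]
  exact Finset.sum_nonneg fun l _ => star_mul_self_nonneg _

theorem eq_zero_of_star_mul_self_diag {k : ℕ} {Z : CStarMatrix (Fin k) (Fin k) A}
    (h : ∀ m, (star Z * Z) m m ≤ 0) : Z = 0 := by
  ext i j
  have h1 : (star Z * Z) j j = ∑ l, star (Z l j) * Z l j := by
    simp only [CStarMatrix.mul_apply, CStarMatrix.star_apply]
  have h2 : star (Z i j) * Z i j ≤ ∑ l, star (Z l j) * Z l j :=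
    Finset.single_le_sum (f := fun l => star (Z l j) * Z l j)
      (fun l _ => star_mul_self_nonneg _) (Finset.mem_univ i)
  have h3 : star (Z i j) * Z i j = 0 :=
    le_antisymm (h2.trans (h1 ▸ h j)) (star_mul_self_nonneg _)
  exact CStarRing.star_mul_self_eq_zero_iff _ |>.mp h3

/-- The negative part `C` of a self-adjoint element and the square root `R` of `C`, with the
properties needed to show that `C` vanishes. Like `exists_eq_star_mul_self`, this is meant for
`CStarMatrix`. -/
theorem exists_negPart {Y : A} (hY : IsSelfAdjoint Y) :
    ∃ C R : A, star C = C ∧ star R = R ∧ R * R = C ∧ Y * C = -(C * C) ∧ (C = 0 → 0 ≤ Y) := by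
  have hC0 : 0 ≤ Y⁻ := CFC.negPart_nonneg Y
  refine ⟨Y⁻, CFC.sqrt Y⁻, (IsSelfAdjoint.of_nonneg hC0).star_eq,
    (IsSelfAdjoint.of_nonneg (CFC.sqrt_nonneg _)).star_eq, CFC.sqrt_mul_sqrt_self _ hC0, ?_,
    (CFC.negPart_eq_zero_iff Y hY).mp⟩
  calc Y * Y⁻ = (Y⁺ - Y⁻) * Y⁻ := by rw [CFC.posPart_sub_negPart Y]
    _ = _ := by rw [sub_mul, CFC.posPart_mul_negPart, zero_sub]

/-- The converse of `sum_conj_nonneg_of_nonneg`. With `C` the negative part of `Y`, the diagonal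
entries of `C * Y * C` are nonnegative by hypothesis; but `C * Y * C = -C ^ 3`, which forces
`C = 0`. -/
theorem nonneg_of_sum_conj_nonneg {k : ℕ} {Y : CStarMatrix (Fin k) (Fin k) A}
    (hY : IsSelfAdjoint Y) (h : ∀ a : Fin k → A, 0 ≤ ∑ i, ∑ j, star (a i) * Y i j * a j) :
    0 ≤ Y := by
  obtain ⟨C, R, hCs, hRs, hRR, hYC, hfin⟩ := exists_negPart hY
  have hZ : R * C = 0 := by
    apply eq_zero_of_star_mul_self_diag
    intro m
    have h3 : star (R * C) * (R * C) = -(star C * Y * C) := by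
      rw [star_mul, hRs, mul_assoc (star C) Y, hYC, hCs, mul_neg, neg_neg,
        mul_assoc, ← mul_assoc R R, hRR]
    rw [h3, CStarMatrix.neg_apply, neg_nonpos]
    have h4 := h (fun i => C i m)
    convert h4 using 1
    rw [CStarMatrix.mul_apply]
    simp only [CStarMatrix.mul_apply, CStarMatrix.star_apply, Finset.sum_mul]
    rw [Finset.sum_comm]
  have hCC : C * C = 0 := by rw [← hRR, mul_assoc, hRR, hZ, mul_zero]
  refine hfin ?_
  rw [← CStarRing.star_mul_self_eq_zero_iff, hCs, hCC]

variable {B : Type*} [CStarAlgebra B] [PartialOrder B] [StarOrderedRing B]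

/-- The Kadison–Schwarz inequality for a subunital completely positive map. It is read off
from the positivity of the matrix with rows `(1, x)` and `(star x, star x * x)`. -/
theorem star_map_mul_map_le (φ : A →CP B) (h1 : φ 1 ≤ 1) (x : A) :
    star (φ x) * φ x ≤ φ (star x * x) := by
  obtain ⟨Z, hZ00, hZ01, hZ10, hZ11⟩ : ∃ Z : CStarMatrix (Fin 2) (Fin 2) A,
      Z 0 0 = 1 ∧ Z 0 1 = x ∧ Z 1 0 = 0 ∧ Z 1 1 = 0 :=
    ⟨CStarMatrix.ofMatrix !![1, x; 0, 0], rfl, rfl, rfl, rfl⟩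
  have hZ : 0 ≤ (star Z * Z).map φ :=
    CompletelyPositiveMapClass.map_cstarMatrix_nonneg' φ 2 _ (star_mul_self_nonneg Z)
  have hx : φ (star x) = star (φ x) := map_star φ x
  -- the vector is chosen to minimize the quadratic form in the case `φ 1 = 1`
  have h := sum_conj_nonneg_of_nonneg hZ ![-φ x, 1]
  simp only [CStarMatrix.map_apply, Fin.sum_univ_two, CStarMatrix.mul_apply,
    CStarMatrix.star_apply, hZ00, hZ01, hZ10, hZ11, Matrix.cons_val_zero, Matrix.cons_val_one,
    star_one, mul_one, one_mul, mul_zero, add_zero, star_neg, mul_neg,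
    neg_mul, neg_neg, hx] at h
  have h2 : star (φ x) * φ 1 * φ x ≤ star (φ x) * 1 * φ x := star_left_conjugate_le_conjugate h1 _
  rw [mul_one] at h2
  have h3 := add_le_add h h2
  rw [← sub_nonneg] at h3 ⊢
  convert h3 using 1
  abel

end CompletelyPositive

/-! ### Weak operator convergence and normal functionals -/

section WeakOperator

variable {H : Type*} [NormedAddCommGroup H] [InnerProductSpace ℂ H] [CompleteSpace H]

/-- Convergence in the weak operator topology, expressed by matrix coefficients. -/
def WTendsto {M : VonNeumannAlgebra H} {ι : Type*} (f : ι → M) (l : Filter ι) (x : M) : Prop :=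
  ∀ ξ η : H, Tendsto (fun i => ⟪ξ, (f i : H →L[ℂ] H) η⟫_ℂ) l (𝓝 ⟪ξ, (x : H →L[ℂ] H) η⟫_ℂ)

theorem tendsto_wot_iff {M : VonNeumannAlgebra H} {ι : Type*} {f : ι → M} {l : Filter ι}
    {x : M} : Tendsto f l (@nhds M (wot M) x) ↔ WTendsto f l x := by
  rw [wot, nhds_induced, tendsto_comap_iff,
    ContinuousLinearMapWOT.tendsto_iff_forall_inner_apply_tendsto]
  exact ⟨fun h ξ η => h η ξ, fun h ξ η => h η ξ⟩

/-- Normality can be tested on ultrafilters, to which the compactness of the unit ball applies. -/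
theorem isNormalFunctional_iff {M : VonNeumannAlgebra H} {ω : M →ₗ[ℂ] ℂ} :
    IsNormalFunctional ω ↔
      ∀ x : M, ‖x‖ ≤ 1 → ∀ U : Ultrafilter M, (∀ᶠ y in (U : Filter M), ‖y‖ ≤ 1) →
        WTendsto id (U : Filter M) x → Tendsto ω U (𝓝 (ω x)) := by
  let _ := wot M
  refine ⟨fun h x hx U hU hw => ?_, fun h x hx => ?_⟩
  · refine (h x hx).mono_left (le_inf ?_ (le_principal_iff.mpr hU))
    exact tendsto_wot_iff.mpr hw
  · refine tendsto_iff_ultrafilter _ _ _ |>.mpr fun U hU => ?_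
    exact h x hx U (le_principal_iff.mp (hU.trans inf_le_right))
      (tendsto_wot_iff.mp (hU.trans inf_le_left))

namespace WTendsto

variable {M : VonNeumannAlgebra H} {ι : Type*} {f : ι → M} {l : Filter ι} {x : M}

theorem const_mul (h : WTendsto f l x) (a : M) : WTendsto (fun i => a * f i) l (a * x) := by
  intro ξ η
  have := h (star (a : H →L[ℂ] H) ξ) η
  simp only [ContinuousLinearMap.star_eq_adjoint, ContinuousLinearMap.adjoint_inner_left] at this
  exact this

theorem mul_const (h : WTendsto f l x) (a : M) : WTendsto (fun i => f i * a) l (x * a) :=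
  fun ξ η => h ξ ((a : H →L[ℂ] H) η)

theorem const_smul (h : WTendsto f l x) (c : ℂ) : WTendsto (fun i => c • f i) l (c • x) := by
  intro ξ η
  have := (h ξ η).const_mul c
  simp only [← inner_smul_right] at this
  exact this

end WTendsto

/-- Normal functionals are weakly continuous on all bounded sets, not only on the unit ball. -/
theorem IsNormalFunctional.tendsto {M : VonNeumannAlgebra H} {ω : M →ₗ[ℂ] ℂ}
    (hω : IsNormalFunctional ω) {ι : Type*} {f : ι → M} {l : Filter ι} {x : M} {C : ℝ}
    (hf : ∀ᶠ i in l, ‖f i‖ ≤ C) (hx : ‖x‖ ≤ C) (h : WTendsto f l x) :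
    Tendsto (fun i => ω (f i)) l (𝓝 (ω x)) := by
  let _ := wot M
  set D : ℝ := max C 1
  have hD : 0 < D := lt_of_lt_of_le one_pos (le_max_right _ _)
  have hD' : (D : ℂ) ≠ 0 := by exact_mod_cast hD.ne'
  have key : ∀ y : M, ‖y‖ ≤ C → ‖(D⁻¹ : ℂ) • y‖ ≤ 1 := fun y hy => by
    rw [norm_smul, norm_inv, Complex.norm_real, Real.norm_of_nonneg hD.le, inv_mul_le_one₀ hD]
    exact hy.trans (le_max_left _ _)
  have h1 : Tendsto (fun i => (D⁻¹ : ℂ) • f i) l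
      (𝓝[{y : M | ‖y‖ ≤ 1}] ((D⁻¹ : ℂ) • x)) :=
    tendsto_nhdsWithin_iff.mpr ⟨tendsto_wot_iff.mpr (h.const_smul _), hf.mono fun i hi => key _ hi⟩
  have h2 := ((hω _ (key x hx)).tendsto.comp h1).const_mul (D : ℂ)
  simpa [Function.comp_def, hD'] using h2

/-- Bounded sets of a von Neumann algebra are relatively compact in the weak operator topology. The
limits of the matrix coefficients form a bounded sesquilinear form, and the operator which it
defines still commutes with the commutant. -/
theorem exists_wTendsto_of_ultrafilter (M : VonNeumannAlgebra H) {C : ℝ} (U : Ultrafilter M)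
    (hU : ∀ᶠ y in (U : Filter M), ‖y‖ ≤ C) : ∃ x : M, ‖x‖ ≤ C ∧ WTendsto id (U : Filter M) x := by
  have hC : 0 ≤ C := by
    obtain ⟨y, hy⟩ := hU.exists
    exact (norm_nonneg y).trans hy
  have hbd : ∀ ξ η : H, ∀ᶠ y : M in U, ‖⟪(y : H →L[ℂ] H) ξ, η⟫_ℂ‖ ≤ C * ‖ξ‖ * ‖η‖ := by
    intro ξ η
    filter_upwards [hU] with y hy
    refine (norm_inner_le_norm _ _).trans ?_
    gcongr
    exact ((y : H →L[ℂ] H).le_opNorm ξ).trans (by gcongr; exact hy)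
  have hlim : ∀ ξ η : H, ∃ z : ℂ, ‖z‖ ≤ C * ‖ξ‖ * ‖η‖ ∧
      Tendsto (fun y : M => ⟪(y : H →L[ℂ] H) ξ, η⟫_ℂ) U (𝓝 z) := by
    intro ξ η
    obtain ⟨z, hz, hz'⟩ := (isCompact_closedBall (0 : ℂ) (C * ‖ξ‖ * ‖η‖)).ultrafilter_le_nhds
      (U.map fun y : M => ⟪(y : H →L[ℂ] H) ξ, η⟫_ℂ) (by
        rw [le_principal_iff]
        change ∀ᶠ y : M in (U : Filter M), ⟪(y : H →L[ℂ] H) ξ, η⟫_ℂ ∈ _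
        filter_upwards [hbd ξ η] with y hy
        simpa using hy)
    exact ⟨z, by simpa using hz, hz'⟩
  choose b hb hbt using hlim
  let B : H →L⋆[ℂ] H →L[ℂ] ℂ := LinearMap.mkContinuous₂
    (LinearMap.mk₂'ₛₗ (starRingEnd ℂ) (RingHom.id ℂ) b
      (fun ξ ξ' η => tendsto_nhds_unique (hbt _ _) (by
        simpa only [map_add, inner_add_left] using (hbt ξ η).add (hbt ξ' η)))
      (fun c ξ η => tendsto_nhds_unique (hbt _ _) (by
        simpa only [map_smul, inner_smul_left, smul_eq_mul] using (hbt ξ η).const_mul _))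
      (fun ξ η η' => tendsto_nhds_unique (hbt _ _) (by
        simpa only [inner_add_right] using (hbt ξ η).add (hbt ξ η')))
      (fun c ξ η => tendsto_nhds_unique (hbt _ _) (by
        simpa only [inner_smul_right, smul_eq_mul, RingHom.id_apply]
          using (hbt ξ η).const_mul _))) C
    (fun ξ η => hb ξ η)
  let X : H →L[ℂ] H := InnerProductSpace.continuousLinearMapOfBilin B
  have hX : ∀ ξ η, ⟪X ξ, η⟫_ℂ = b ξ η := fun ξ η =>
    InnerProductSpace.continuousLinearMapOfBilin_apply B ξ η
  have hXn : ‖X‖ ≤ C := by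
    refine X.opNorm_le_bound hC fun ξ => ?_
    by_cases h0 : ‖X ξ‖ = 0
    · rw [h0]; positivity
    have h1 := hb ξ (X ξ)
    rw [← hX, inner_self_eq_norm_sq_to_K] at h1
    simp only [Complex.coe_algebraMap, norm_pow, Complex.norm_real, norm_norm] at h1
    have h2 : 0 < ‖X ξ‖ := lt_of_le_of_ne (norm_nonneg _) (Ne.symm h0)
    nlinarith
  have hXM : X ∈ M := by
    rw [← SetLike.mem_coe, ← M.centralizer_centralizer, Set.mem_centralizer_iff]
    intro t ht
    have hcomm : ∀ y : M, t * (y : H →L[ℂ] H) = y * t := fun y =>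
      (Set.mem_centralizer_iff.mp ht _ y.2).symm
    ext ξ
    refine ext_inner_right ℂ fun η => ?_
    change ⟪t (X ξ), η⟫_ℂ = ⟪X (t ξ), η⟫_ℂ
    rw [← ContinuousLinearMap.adjoint_inner_right, hX, hX]
    refine tendsto_nhds_unique (hbt _ _) ((hbt (t ξ) η).congr fun y => ?_)
    rw [ContinuousLinearMap.adjoint_inner_right]
    exact congrArg (fun z : H →L[ℂ] H => ⟪z ξ, η⟫_ℂ) (hcomm y).symm
  refine ⟨⟨X, hXM⟩, hXn, fun ξ η => ?_⟩
  have h1 := (Complex.continuous_conj.tendsto _).comp (hbt η ξ)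
  rw [← hX] at h1
  simp only [Function.comp_def, inner_conj_symm] at h1
  exact h1

end WeakOperator

/-! ### The norm of a trace -/

section Trace

variable {H : Type*} [NormedAddCommGroup H] [InnerProductSpace ℂ H] [CompleteSpace H]
  {M : VonNeumannAlgebra H} (τ : M →ₚ[ℂ] ℂ)

theorem inner_hat (x y : M) : ⟪hat τ x, hat τ y⟫_ℂ = τ (star x * y) :=
  UniformSpace.Completion.inner_coe _ _

theorem norm_hat (x : M) : ‖hat τ x‖ = norm2 τ x := by
  rw [hat, UniformSpace.Completion.norm_coe]
  rfl

theorem denseRange_hat : DenseRange (hat τ) := by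
  have h : DenseRange ((↑) : τ.PreGNS → τ.GNS) := UniformSpace.Completion.denseRange_coe
  have h2 := Set.range_comp ((↑) : τ.PreGNS → τ.GNS) τ.toPreGNS
  rw [τ.toPreGNS.surjective.range_eq, Set.image_univ] at h2
  rw [DenseRange] at h ⊢
  rwa [← h2] at h

theorem hat_add (x y : M) : hat τ (x + y) = hat τ x + hat τ y := by
  simp only [hat, map_add, UniformSpace.Completion.coe_add]

theorem hat_sub (x y : M) : hat τ (x - y) = hat τ x - hat τ y := by
  simp only [hat, map_sub, UniformSpace.Completion.coe_sub]

theorem hat_smul (c : ℂ) (x : M) : hat τ (c • x) = c • hat τ x := by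
  simp only [hat, map_smul, UniformSpace.Completion.coe_smul]

theorem norm2_nonneg (x : M) : 0 ≤ norm2 τ x := Real.sqrt_nonneg _

theorem norm2_add_le (x y : M) : norm2 τ (x + y) ≤ norm2 τ x + norm2 τ y := by
  simpa only [← norm_hat, hat_add] using norm_add_le _ _

theorem norm2_sub_le_add (x y z : M) : norm2 τ (x - z) ≤ norm2 τ (x - y) + norm2 τ (y - z) := by
  simpa using norm2_add_le τ (x - y) (y - z)

theorem norm2_smul (c : ℂ) (x : M) : norm2 τ (c • x) = ‖c‖ * norm2 τ x := by
  simp only [← norm_hat, hat_smul, norm_smul]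

theorem norm2_sub_comm (x y : M) : norm2 τ (x - y) = norm2 τ (y - x) := by
  simp only [← norm_hat, hat_sub, norm_sub_rev]

theorem ofReal_norm2_sq (x : M) : ((norm2 τ x ^ 2 : ℝ) : ℂ) = τ (star x * x) := by
  rw [← inner_hat, ← norm_hat, inner_self_eq_norm_sq_to_K]
  simp

theorem norm2_sq (x : M) : norm2 τ x ^ 2 = (τ (star x * x)).re := by
  rw [← ofReal_norm2_sq, Complex.ofReal_re]

theorem norm_trace_star_mul_le (x y : M) : ‖τ (star x * y)‖ ≤ norm2 τ x * norm2 τ y := by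
  simpa only [inner_hat, norm_hat] using norm_inner_le_norm (𝕜 := ℂ) (hat τ x) (hat τ y)

/-- Left multiplication by `a` is bounded by `‖a‖` on `L²`. -/
theorem norm2_mul_le (a x : M) : norm2 τ (a * x) ≤ ‖a‖ * norm2 τ x := by
  have := (τ.leftMulMapPreGNS a).le_of_opNorm_le
    (LinearMap.mkContinuous_norm_le _ (norm_nonneg _) _) (τ.toPreGNS x)
  exact this

namespace IsTrace

variable {τ} (hτ : IsTrace M τ)
include hτ

theorem eq_of_forall {x y : M} (h : ∀ a : M, τ (a * x) = τ (a * y)) : x = y := by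
  refine sub_eq_zero.mp (hτ.faithful _ ?_)
  rw [mul_sub, map_sub, h, sub_self]

theorem norm2_one : norm2 τ 1 = 1 := by
  simp [norm2, hτ.map_one]

theorem norm2_le_norm (x : M) : norm2 τ x ≤ ‖x‖ := by
  simpa [hτ.norm2_one] using norm2_mul_le τ x 1

theorem tendsto_of_wTendsto {ι : Type*} {f : ι → M} {l : Filter ι} {x : M} {C : ℝ}
    (hf : ∀ᶠ i in l, ‖f i‖ ≤ C) (hx : ‖x‖ ≤ C) (h : WTendsto f l x) (a : M) :
    Tendsto (fun i => τ (a * f i)) l (𝓝 (τ (a * x))) := by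
  refine hτ.normal.tendsto (C := ‖a‖ * C) ?_ ?_ (h.const_mul a)
  · filter_upwards [hf] with i hi
    exact (norm_mul_le _ _).trans (by gcongr)
  · exact (norm_mul_le _ _).trans (by gcongr)

/-- On bounded sets, the functionals `τ(a ·)` determine weak convergence: by weak compactness there
are cluster points, and faithfulness of `τ` shows that `x` is the only one. -/
theorem wTendsto_of_tendsto {ι : Type*} {f : ι → M} {l : Filter ι} {x : M} {C : ℝ}
    (hf : ∀ᶠ i in l, ‖f i‖ ≤ C)
    (h : ∀ a : M, Tendsto (fun i => τ (a * f i)) l (𝓝 (τ (a * x)))) : WTendsto f l x := by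
  rw [← tendsto_wot_iff]
  let _ := wot M
  refine tendsto_iff_ultrafilter _ _ _ |>.mpr fun U hU => ?_
  have hfU : ∀ᶠ i in (U : Filter ι), ‖f i‖ ≤ C := hU hf
  obtain ⟨y, hy, hyU⟩ := exists_wTendsto_of_ultrafilter M (U.map f) (C := C) hfU
  have hyU' : WTendsto f (U : Filter ι) y := fun ξ η => hyU ξ η
  have : x = y := hτ.eq_of_forall fun a =>
    tendsto_nhds_unique ((h a).mono_left hU) (hτ.tendsto_of_wTendsto hfU hy hyU' a)
  rw [tendsto_wot_iff, this]
  exact hyU'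

end IsTrace

section Restrict

variable {N : VonNeumannAlgebra H} {τ : N →ₚ[ℂ] ℂ}

theorem wTendsto_incl (h : M ≤ N) {ι : Type*} {f : ι → M} {l : Filter ι} {x : M}
    (hf : WTendsto f l x) : WTendsto (fun i => inclCLM h (f i)) l (inclCLM h x) := hf

theorem isNormalMap_incl (h : M ≤ N) : IsNormalMap (inclCLM h).toLinearMap := by
  intro ω hω
  rw [isNormalFunctional_iff]
  intro x hx U hU hw
  exact hω.tendsto (C := 1) (f := fun y : M => inclCLM h y) hU hx (wTendsto_incl h hw)

theorem restrict_apply (h : M ≤ N) (x : M) : restrict h τ x = τ (inclCLM h x) := rfl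

theorem inclCLM_mul (h : M ≤ N) (x y : M) : inclCLM h (x * y) = inclCLM h x * inclCLM h y := rfl

theorem inclCLM_star (h : M ≤ N) (x : M) : inclCLM h (star x) = star (inclCLM h x) := rfl

theorem inclCLM_one (h : M ≤ N) : inclCLM h (1 : M) = 1 := rfl

theorem inclCLM_injective (h : M ≤ N) : Function.Injective (inclCLM h) :=
  fun _ _ hxy => Subtype.ext (congrArg (fun z : N => (z : H →L[ℂ] H)) hxy)

theorem norm2_inclCLM (h : M ≤ N) (x : M) : norm2 τ (inclCLM h x) = norm2 (restrict h τ) x := rfl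

theorem IsTrace.restrict (hτ : IsTrace N τ) (h : M ≤ N) : IsTrace M (restrict h τ) where
  map_one := hτ.map_one
  map_mul_comm x y := hτ.map_mul_comm (inclCLM h x) (inclCLM h y)
  faithful x hx := inclCLM_injective h (by
    rw [map_zero]
    exact hτ.faithful (inclCLM h x) hx)
  normal := isNormalMap_incl h _ hτ.normal

end Restrict

end Trace

/-! ### A Radon–Nikodym theorem for subalgebras -/

section Calculus

variable {A : Type*} [CStarAlgebra A] [PartialOrder A] [StarOrderedRing A]

/-- An approximate version of the spectral projection onto the positive part: `k` is a contraction
which multiplies `b` to its positive part `p`, up to `ε`. -/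
theorem exists_almost_posPart {b : A} (hb : IsSelfAdjoint b) {ε : ℝ} (hε : 0 < ε) :
    ∃ p m k : A, 0 ≤ p ∧ 0 ≤ m ∧ b = p - m ∧ 0 ≤ k ∧ k ≤ 1 ∧ p ≤ b * k + algebraMap ℝ A ε := by
  have hcp : Continuous fun t : ℝ => max t 0 := by fun_prop
  have hcm : Continuous fun t : ℝ => max (-t) 0 := by fun_prop
  have hck : Continuous fun t : ℝ => min 1 (max t 0 / ε) := by fun_prop
  refine ⟨cfc (fun t : ℝ => max t 0) b, cfc (fun t : ℝ => max (-t) 0) b,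
    cfc (fun t : ℝ => min 1 (max t 0 / ε)) b, cfc_nonneg fun t _ => le_max_right _ _,
    cfc_nonneg fun t _ => le_max_right _ _, ?_, cfc_nonneg fun t _ => by positivity,
    cfc_le_one _ _ fun t _ => min_le_left _ _, ?_⟩
  · rw [← cfc_sub (fun t : ℝ => max t 0) (fun t : ℝ => max (-t) 0) b hcp.continuousOn
      hcm.continuousOn]
    conv_lhs => rw [← cfc_id' ℝ b hb]
    refine cfc_congr fun t _ => ?_
    rcases le_total 0 t with h | h
    · simp [h]
    · simp [h]
  · have h1 : b * cfc (fun t : ℝ => min 1 (max t 0 / ε)) b + algebraMap ℝ A ε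
        = cfc (fun t : ℝ => t * min 1 (max t 0 / ε) + ε) b := by
      rw [cfc_add_const ε (fun t : ℝ => t * min 1 (max t 0 / ε)) b (by fun_prop) hb,
        cfc_mul (fun t : ℝ => t) _ b continuousOn_id hck.continuousOn, cfc_id' ℝ b hb]
    rw [h1]
    refine cfc_mono (fun t _ => ?_) hcp.continuousOn (by fun_prop)
    rcases le_total t 0 with h | h
    · simp [h, hε.le]
    · rw [max_eq_left h]
      rcases le_total ε t with h' | h'
      · rw [min_eq_left ((one_le_div hε).mpr h')]
        linarith
      · have : 0 ≤ t * min 1 (t / ε) := by positivity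
        linarith

end Calculus

section CondExp

variable {H : Type*} [NormedAddCommGroup H] [InnerProductSpace ℂ H] [CompleteSpace H]

theorem nonneg_of_wTendsto {M : VonNeumannAlgebra H} {ι : Type*} {f : ι → M} {l : Filter ι}
    [l.NeBot] {x : M} (h : WTendsto f l x) (hf : ∀ᶠ i in l, 0 ≤ f i) : 0 ≤ x := by
  change (0 : H →L[ℂ] H) ≤ x
  rw [ContinuousLinearMap.nonneg_iff_isPositive, ContinuousLinearMap.isPositive_iff_complex]
  intro ξ
  have h1 : 0 ≤ ⟪ξ, (x : H →L[ℂ] H) ξ⟫_ℂ := by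
    refine ge_of_tendsto (h ξ ξ) (hf.mono fun i hi => ?_)
    have hi' : (0 : H →L[ℂ] H) ≤ f i := hi
    exact ((ContinuousLinearMap.nonneg_iff_isPositive _).mp hi').inner_nonneg_right ξ
  rw [← inner_conj_symm] at h1
  have h2 : 0 ≤ ⟪(x : H →L[ℂ] H) ξ, ξ⟫_ℂ := by
    have := star_nonneg_iff.mpr h1
    simpa using this
  rw [Complex.nonneg_iff] at h2
  exact ⟨Complex.ext rfl h2.2, h2.1⟩

variable {P N : VonNeumannAlgebra H} {τ : N →ₚ[ℂ] ℂ}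

/-- The isometry `L²(P) → L²(N)` that extends the inclusion `P ⊆ N`. -/
noncomputable def inclL2 (h : P ≤ N) (τ : N →ₚ[ℂ] ℂ) : (restrict h τ).GNS →L[ℂ] τ.GNS :=
  ContinuousLinearMap.completion <| LinearMap.mkContinuous
    (τ.toPreGNS.toLinearMap ∘ₗ (inclCLM h).toLinearMap ∘ₗ (restrict h τ).ofPreGNS.toLinearMap) 1
    (fun x => by rw [one_mul]; exact le_of_eq rfl)

theorem inclL2_hat (h : P ≤ N) (x : P) :
    inclL2 h τ (hat (restrict h τ) x) = hat τ (inclCLM h x) :=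
  ContinuousLinearMap.completion_apply_coe _ _

theorem inner_hat_adjoint_inclL2 (h : P ≤ N) (a : P) (x : N) :
    ⟪hat (restrict h τ) a, (inclL2 h τ).adjoint (hat τ x)⟫_ℂ = τ (star (inclCLM h a) * x) := by
  rw [ContinuousLinearMap.adjoint_inner_right, inclL2_hat, inner_hat]

theorem eq_of_inner_hat {σ : P →ₚ[ℂ] ℂ} {ξ η : σ.GNS}
    (h : ∀ a : P, ⟪hat σ a, ξ⟫_ℂ = ⟪hat σ a, η⟫_ℂ) : ξ = η :=
  (denseRange_hat σ).eq_of_inner_right ℂ h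

namespace IsTrace

/-- The positive part of the unit ball is closed in `L²`, because it is weakly compact. -/
theorem isClosed_image_hat {σ : P →ₚ[ℂ] ℂ} (hσ : IsTrace P σ) :
    IsClosed (hat σ '' {k : P | 0 ≤ k ∧ k ≤ 1}) := by
  refine isClosed_of_closure_subset fun η hη => ?_
  obtain ⟨U, hU, hUη⟩ := mem_closure_iff_ultrafilter.mp hη
  choose! g hg hgη using fun v (hv : v ∈ hat σ '' {k : P | 0 ≤ k ∧ k ≤ 1}) => hv
  have hU' : ∀ᶠ v in (U : Filter σ.GNS), v ∈ hat σ '' {k : P | 0 ≤ k ∧ k ≤ 1} := hU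
  have hnorm : ∀ᶠ v in (U : Filter σ.GNS), ‖g v‖ ≤ 1 := hU'.mono fun v hv =>
    (CStarAlgebra.norm_le_one_iff_of_nonneg _ (hg v hv).1).mpr (hg v hv).2
  obtain ⟨k, hk, hkU⟩ := exists_wTendsto_of_ultrafilter P (U.map g) (C := 1) hnorm
  have hw : WTendsto g (U : Filter σ.GNS) k := fun ξ η => hkU ξ η
  have hk0 : 0 ≤ k := nonneg_of_wTendsto hw (hU'.mono fun v hv => (hg v hv).1)
  refine ⟨k, ⟨hk0, (CStarAlgebra.norm_le_one_iff_of_nonneg _ hk0).mp hk⟩, ?_⟩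
  refine eq_of_inner_hat fun a => ?_
  have h1 : Tendsto (fun v => ⟪hat σ a, v⟫_ℂ) (U : Filter σ.GNS) (𝓝 ⟪hat σ a, η⟫_ℂ) :=
    (continuous_const.inner continuous_id).tendsto η |>.mono_left hUη
  refine tendsto_nhds_unique ?_ h1
  rw [inner_hat]
  refine (hσ.tendsto_of_wTendsto hnorm hk hw (star a)).congr' ?_
  filter_upwards [hU'] with v hv
  rw [← inner_hat, hgη v hv]

/-- For a trace, `τ(x c) = τ(c^{1/2} x c^{1/2})`. -/
theorem trace_mul_nonneg (hτ : IsTrace N τ) {x c : N} (hx : 0 ≤ x) (hc : 0 ≤ c) :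
    0 ≤ τ (x * c) := by
  have hs : star (CFC.sqrt c) = CFC.sqrt c := (IsSelfAdjoint.of_nonneg (CFC.sqrt_nonneg c)).star_eq
  have h1 : τ (x * c) = τ (star (CFC.sqrt c) * x * CFC.sqrt c) := by
    conv_lhs => rw [← CFC.sqrt_mul_sqrt_self c hc]
    rw [← mul_assoc, hτ.map_mul_comm, ← mul_assoc, hs]
  rw [h1]
  exact τ.map_nonneg (star_left_conjugate_nonneg hx _)

theorem map_star_mul (τ : N →ₚ[ℂ] ℂ) (x y : N) :
    τ (star x * y) = (starRingEnd ℂ) (τ (star y * x)) := by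
  rw [← inner_hat, ← inner_hat, inner_conj_symm]

/-- A Radon–Nikodym theorem: for `0 ≤ x ≤ 1` the functional `τ(· x)` on `P` is of the form
`τ(· k)` with `0 ≤ k ≤ 1` in `P`. Otherwise the Hahn–Banach theorem in `L²(P)` separates it from
all such `k`, by a self-adjoint `b` in `P`; but `τ(b x) ≤ τ(b⁺)`, and `τ(b k)` comes
arbitrarily close to `τ(b⁺)`. -/
theorem exists_radonNikodym (hτ : IsTrace N τ) (h : P ≤ N) {x : N} (hx0 : 0 ≤ x) (hx1 : x ≤ 1) :
    ∃ k : P, 0 ≤ k ∧ k ≤ 1 ∧ ∀ a : P, τ (inclCLM h a * x) = HaagerupMax.restrict h τ (a * k) := by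
  set σ := HaagerupMax.restrict h τ
  have hσ : IsTrace P σ := hτ.restrict h
  -- `ξ` is the orthogonal projection of `x` to `L²(P)`
  obtain ⟨ξ, hξ⟩ : ∃ ξ : σ.GNS, ∀ a : P, ⟪hat σ a, ξ⟫_ℂ = τ (star (inclCLM h a) * x) :=
    ⟨_, fun a => inner_hat_adjoint_inclL2 h a x⟩
  by_cases hmem : ξ ∈ hat σ '' {k : P | 0 ≤ k ∧ k ≤ 1}
  · obtain ⟨k, hk, hkξ⟩ := hmem
    refine ⟨k, hk.1, hk.2, fun a => ?_⟩
    have h1 := hξ (star a)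
    rw [← hkξ, inner_hat, star_star, inclCLM_star, star_star] at h1
    exact h1.symm
  exfalso
  have hconv : Convex ℝ (hat σ '' {k : P | 0 ≤ k ∧ k ≤ 1}) := by
    rintro _ ⟨k, hk, rfl⟩ _ ⟨k', hk', rfl⟩ s t hs ht hst
    refine ⟨(s : ℂ) • k + (t : ℂ) • k', ⟨?_, ?_⟩, ?_⟩
    · exact add_nonneg (smul_nonneg (by exact_mod_cast hs) hk.1)
        (smul_nonneg (by exact_mod_cast ht) hk'.1)
    · have h1 : (1 : P) = (s : ℂ) • 1 + (t : ℂ) • 1 := by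
        rw [← add_smul, ← Complex.ofReal_add, hst, Complex.ofReal_one, one_smul]
      rw [h1]
      exact add_le_add (smul_le_smul_of_nonneg_left hk.2 (by exact_mod_cast hs))
        (smul_le_smul_of_nonneg_left hk'.2 (by exact_mod_cast ht))
    · rw [hat_add, hat_smul, hat_smul, Complex.coe_smul, Complex.coe_smul]
  obtain ⟨f, u, hfu, huf⟩ := RCLike.geometric_hahn_banach_closed_point (𝕜 := ℂ) hconv
    hσ.isClosed_image_hat hmem
  obtain ⟨η, rfl⟩ := (InnerProductSpace.toDual ℂ σ.GNS).surjective f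
  simp only [InnerProductSpace.toDual_apply_apply] at hfu huf
  obtain ⟨d, hd, hdu⟩ : ∃ d : ℝ, 0 < d ∧ u + 2 * d = RCLike.re ⟪η, ξ⟫_ℂ :=
    ⟨(RCLike.re ⟪η, ξ⟫_ℂ - u) / 2, by linarith, by ring⟩
  have hden : 0 < d / (‖ξ‖ + 1) := by positivity
  obtain ⟨a, ha⟩ := (denseRange_hat σ).exists_dist_lt η hden
  have hsep : ∀ k : P, 0 ≤ k → k ≤ 1 → d ≤ (⟪hat σ a, ξ - hat σ k⟫_ℂ).re := by
    intro k hk0 hk1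
    have h1 := hfu _ ⟨k, ⟨hk0, hk1⟩, rfl⟩
    have h2 : ‖⟪η - hat σ a, ξ - hat σ k⟫_ℂ‖ ≤ d := by
      refine (norm_inner_le_norm _ _).trans ?_
      have h3 : ‖ξ - hat σ k‖ ≤ ‖ξ‖ + 1 := by
        refine (norm_sub_le _ _).trans ?_
        gcongr
        rw [norm_hat]
        exact (hσ.norm2_le_norm k).trans ((CStarAlgebra.norm_le_one_iff_of_nonneg _ hk0).mpr hk1)
      rw [dist_eq_norm] at ha
      calc ‖η - hat σ a‖ * ‖ξ - hat σ k‖ ≤ d / (‖ξ‖ + 1) * (‖ξ‖ + 1) := by gcongr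
        _ = d := by field_simp
    have h4 := (Complex.re_le_norm _).trans h2
    have h5 : ⟪hat σ a, ξ - hat σ k⟫_ℂ
        = ⟪η, ξ⟫_ℂ - ⟪η, hat σ k⟫_ℂ - ⟪η - hat σ a, ξ - hat σ k⟫_ℂ := by
      simp only [inner_sub_left, inner_sub_right]
      ring
    rw [h5, Complex.sub_re, Complex.sub_re]
    simp only [RCLike.re_to_complex] at h1 hdu
    linarith
  -- the separating vector may be taken to be self-adjoint
  set b : P := a + star a with hb
  have hbs : IsSelfAdjoint b := IsSelfAdjoint.add_star_self a
  have hx_s : star x = x := (IsSelfAdjoint.of_nonneg hx0).star_eq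
  have hsepb : ∀ k : P, 0 ≤ k → k ≤ 1 →
      2 * d ≤ (τ (inclCLM h b * x)).re - (σ (b * k)).re := by
    intro k hk0 hk1
    have h1 := hsep k hk0 hk1
    have hk_s : star k = k := (IsSelfAdjoint.of_nonneg hk0).star_eq
    rw [inner_sub_right, hξ, inner_hat, Complex.sub_re] at h1
    have h2 : (τ (inclCLM h a * x)).re = (τ (star (inclCLM h a) * x)).re := by
      rw [map_star_mul, Complex.conj_re, hx_s, hτ.map_mul_comm]
    have h3 : (σ (a * k)).re = (σ (star a * k)).re := by
      rw [map_star_mul, Complex.conj_re, hk_s, hσ.map_mul_comm]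
    rw [hb, map_add, inclCLM_star, add_mul, add_mul, map_add, map_add, Complex.add_re,
      Complex.add_re, h2, h3]
    linarith
  -- compare `x` with the approximate projection `k` onto the positive part `p` of `b`
  obtain ⟨p, m, k, hp, hm, hbpm, hk0, hk1, hpk⟩ := exists_almost_posPart hbs hd
  have h1 := hsepb k hk0 hk1
  have h2 : (τ (inclCLM h b * x)).re ≤ (σ p).re := by
    have h3 : 0 ≤ τ (inclCLM h m * x) := hτ.trace_mul_nonneg (c := x) (x := inclCLM h m) hm hx0
    have h4 : 0 ≤ τ (inclCLM h p * (1 - x)) :=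
      hτ.trace_mul_nonneg (c := 1 - x) (x := inclCLM h p) hp (sub_nonneg.mpr hx1)
    rw [mul_sub, mul_one, map_sub] at h4
    rw [hbpm, map_sub, sub_mul, map_sub, Complex.sub_re]
    have h5 := (Complex.nonneg_iff.mp h3).1
    have h6 := (Complex.nonneg_iff.mp h4).1
    rw [Complex.sub_re] at h6
    have h7 : (σ p).re = (τ (inclCLM h p)).re := rfl
    linarith
  have h3 : (σ p).re ≤ (σ (b * k)).re + d := by
    have h4 := OrderHomClass.mono σ hpk
    have h5 : algebraMap ℝ P d = (d : ℂ) • (1 : P) := by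
      rw [Algebra.algebraMap_eq_smul_one, Complex.coe_smul]
    rw [map_add, h5, map_smul, hσ.map_one] at h4
    have h6 := (Complex.le_def.mp h4).1
    simpa using h6
  linarith

theorem exists_radonNikodym_of_nonneg (hτ : IsTrace N τ) (h : P ≤ N) {x : N} (hx : 0 ≤ x) :
    ∃ k : P, 0 ≤ k ∧ ∀ a : P, τ (inclCLM h a * x) = HaagerupMax.restrict h τ (a * k) := by
  have hc : 0 < ‖x‖ + 1 := by positivity
  have hc0 : ((‖x‖ + 1 : ℝ) : ℂ) ≠ 0 := by exact_mod_cast hc.ne'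
  have hy0 : 0 ≤ (((‖x‖ + 1 : ℝ) : ℂ)⁻¹ • x) :=
    smul_nonneg (inv_nonneg.mpr (by exact_mod_cast hc.le)) hx
  obtain ⟨k, hk0, -, hk⟩ := hτ.exists_radonNikodym h hy0 (by
    rw [← CStarAlgebra.norm_le_one_iff_of_nonneg _ hy0, norm_smul, norm_inv, Complex.norm_real,
      Real.norm_of_nonneg hc.le, inv_mul_le_one₀ hc]
    linarith)
  refine ⟨((‖x‖ + 1 : ℝ) : ℂ) • k, smul_nonneg (by exact_mod_cast hc.le) hk0, fun a => ?_⟩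
  rw [mul_smul_comm, map_smul, ← hk, mul_smul_comm, map_smul, smul_smul, mul_inv_cancel₀ hc0,
    one_smul]

theorem exists_condExp (hτ : IsTrace N τ) (h : P ≤ N) (x : N) :
    ∃ y : P, ∀ a : P, τ (inclCLM h a * x) = HaagerupMax.restrict h τ (a * y) := by
  have hx : x ∈ Submodule.span ℂ {a : N | 0 ≤ a} := by
    rw [CStarAlgebra.span_nonneg]
    trivial
  induction hx using Submodule.span_induction with
  | mem x hx =>
    obtain ⟨k, -, hk⟩ := hτ.exists_radonNikodym_of_nonneg h hx
    exact ⟨k, hk⟩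
  | zero => exact ⟨0, fun a => by simp⟩
  | add x y _ _ hx hy =>
    obtain ⟨k, hk⟩ := hx
    obtain ⟨l, hl⟩ := hy
    exact ⟨k + l, fun a => by rw [mul_add, map_add, hk, hl, mul_add, map_add]⟩
  | smul c x _ hx =>
    obtain ⟨k, hk⟩ := hx
    exact ⟨c • k, fun a => by rw [mul_smul_comm, map_smul, hk, mul_smul_comm, map_smul]⟩

end IsTrace

end CondExp

/-! ### The conditional expectation -/

section CondExpMap

variable {H : Type*} [NormedAddCommGroup H] [InnerProductSpace ℂ H] [CompleteSpace H]
  {P N : VonNeumannAlgebra H} {τ : N →ₚ[ℂ] ℂ}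

theorem norm_one_le_one (M : VonNeumannAlgebra H) : ‖(1 : M)‖ ≤ 1 := by
  change ‖(1 : H →L[ℂ] H)‖ ≤ 1
  exact ContinuousLinearMap.norm_id_le

/-- The trace-preserving conditional expectation `N → P`. -/
noncomputable def condExp (hτ : IsTrace N τ) (h : P ≤ N) : N →ₗ[ℂ] P where
  toFun x := (hτ.exists_condExp h x).choose
  map_add' x y := (hτ.restrict h).eq_of_forall fun a => by
    rw [← (hτ.exists_condExp h (x + y)).choose_spec a, mul_add, mul_add, map_add, map_add,
      (hτ.exists_condExp h x).choose_spec a, (hτ.exists_condExp h y).choose_spec a]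
  map_smul' c x := (hτ.restrict h).eq_of_forall fun a => by
    rw [← (hτ.exists_condExp h (c • x)).choose_spec a, RingHom.id_apply, mul_smul_comm,
      mul_smul_comm, map_smul, map_smul, (hτ.exists_condExp h x).choose_spec a]

section

variable (hτ : IsTrace N τ) (h : P ≤ N)

theorem restrict_mul_condExp (a : P) (x : N) :
    restrict h τ (a * condExp hτ h x) = τ (inclCLM h a * x) :=
  ((hτ.exists_condExp h x).choose_spec a).symm

theorem condExp_unique {x : N} {y : P}
    (hy : ∀ a : P, τ (inclCLM h a * x) = restrict h τ (a * y)) : condExp hτ h x = y :=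
  (hτ.restrict h).eq_of_forall fun a => (restrict_mul_condExp hτ h a x).trans (hy a)

theorem condExp_nonneg {x : N} (hx : 0 ≤ x) : 0 ≤ condExp hτ h x := by
  obtain ⟨k, hk, hkx⟩ := hτ.exists_radonNikodym_of_nonneg h hx
  rwa [condExp_unique hτ h hkx]

theorem condExp_inclCLM (a : P) : condExp hτ h (inclCLM h a) = a :=
  condExp_unique hτ h fun _ => rfl

theorem condExp_one : condExp hτ h 1 = 1 := condExp_inclCLM hτ h 1

/-- The bimodule property. -/
theorem condExp_mul_mul (a b : P) (x : N) :
    condExp hτ h (inclCLM h a * x * inclCLM h b) = a * condExp hτ h x * b := by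
  refine condExp_unique hτ h fun c => ?_
  have h1 : τ (inclCLM h c * (inclCLM h a * x * inclCLM h b)) = τ (inclCLM h (b * c * a) * x) := by
    rw [← mul_assoc, hτ.map_mul_comm, inclCLM_mul, inclCLM_mul]
    simp only [mul_assoc]
  have h2 : restrict h τ (c * (a * condExp hτ h x * b))
      = restrict h τ (b * c * a * condExp hτ h x) := by
    rw [← mul_assoc, (hτ.restrict h).map_mul_comm]
    simp only [mul_assoc]
  rw [h1, h2, restrict_mul_condExp]

theorem condExp_star (x : N) : condExp hτ h (star x) = star (condExp hτ h x) := by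
  refine condExp_unique hτ h fun a => ?_
  have h1 : τ (inclCLM h a * star x) = (starRingEnd ℂ) (τ (inclCLM h (star a) * x)) := by
    rw [inclCLM_star, IsTrace.map_star_mul, Complex.conj_conj, hτ.map_mul_comm]
  have h2 : restrict h τ (a * star (condExp hτ h x))
      = (starRingEnd ℂ) (restrict h τ (star a * condExp hτ h x)) := by
    rw [IsTrace.map_star_mul, Complex.conj_conj, (hτ.restrict h).map_mul_comm]
  rw [h1, h2, restrict_mul_condExp]

theorem trace_condExp (x : N) : restrict h τ (condExp hτ h x) = τ x := by
  simpa [inclCLM_one] using restrict_mul_condExp hτ h 1 x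

/-- The conditional expectation is completely positive, since it is a positive bimodule map. -/
noncomputable def condExpCP : N →CP P where
  toLinearMap := condExp hτ h
  map_cstarMatrix_nonneg' k Y hY := by
    have hYs : star Y = Y := (IsSelfAdjoint.of_nonneg hY).star_eq
    refine nonneg_of_sum_conj_nonneg ?_ fun a => ?_
    · refine CStarMatrix.ext fun i j => ?_
      rw [CStarMatrix.star_apply, CStarMatrix.map_apply, CStarMatrix.map_apply, ← condExp_star,
        ← CStarMatrix.star_apply, hYs]
    · have h1 := condExp_nonneg hτ h (sum_conj_nonneg_of_nonneg hY fun i => inclCLM h (a i))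
      simp only [map_sum, ← inclCLM_star, condExp_mul_mul] at h1
      exact h1

theorem condExpCP_apply (x : N) : condExpCP hτ h x = condExp hτ h x := rfl

/-- By the Kadison–Schwarz inequality, `E(x)⋆ E(x) ≤ E(x⋆ x) ≤ ‖x‖²`. -/
theorem norm_condExp_le (x : N) : ‖condExp hτ h x‖ ≤ ‖x‖ := by
  have h1 := star_map_mul_map_le (condExpCP hτ h) (condExp_one hτ h).le x
  have h2 : condExp hτ h (star x * x) ≤ ((‖x‖ ^ 2 : ℝ) : ℂ) • (1 : P) := by
    have h3 : star x * x ≤ ((‖x‖ ^ 2 : ℝ) : ℂ) • (1 : N) := by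
      have := CStarAlgebra.star_mul_le_algebraMap_norm_sq (a := x)
      rwa [Algebra.algebraMap_eq_smul_one, ← Complex.coe_smul] at this
    have h4 := condExp_nonneg hτ h (sub_nonneg.mpr h3)
    rwa [map_sub, map_smul, condExp_one, sub_nonneg] at h4
  have h5 := CStarAlgebra.norm_le_norm_of_nonneg_of_le (star_mul_self_nonneg _) (h1.trans h2)
  rw [CStarRing.norm_star_mul_self, norm_smul, Complex.norm_real, condExpCP_apply] at h5
  have h6 := norm_one_le_one P
  rw [Real.norm_of_nonneg (by positivity)] at h5
  have h7 : ‖condExp hτ h x‖ * ‖condExp hτ h x‖ ≤ ‖x‖ * ‖x‖ :=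
    h5.trans ((mul_le_of_le_one_right (by positivity) h6).trans (pow_two _).le)
  exact (mul_self_le_mul_self_iff (norm_nonneg _) (norm_nonneg _)).mpr h7

/-- The functionals `τ(a ·)` on `P` are pulled back to functionals of the same form, and these
determine weak convergence on bounded sets. -/
theorem isNormalMap_condExp : IsNormalMap (condExp hτ h) := by
  intro ω hω
  rw [isNormalFunctional_iff]
  intro x hx U hU hw
  have hb : ∀ᶠ y in (U : Filter N), ‖condExp hτ h y‖ ≤ 1 :=
    hU.mono fun y hy => (norm_condExp_le hτ h y).trans hy
  refine hω.tendsto (C := 1) hb ((norm_condExp_le hτ h x).trans hx) ?_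
  refine (hτ.restrict h).wTendsto_of_tendsto hb fun a => ?_
  simp only [restrict_mul_condExp]
  exact hτ.tendsto_of_wTendsto (f := id) hU hx hw _

/-- On `L²(N)`, the conditional expectation acts as the orthogonal projection onto `L²(P)`. -/
theorem hat_condExp (x : N) :
    hat (restrict h τ) (condExp hτ h x) = (inclL2 h τ).adjoint (hat τ x) :=
  eq_of_inner_hat fun a => by
    rw [inner_hat_adjoint_inclL2, inner_hat, restrict_mul_condExp, inclCLM_star]

/-- `condExp hτ h x` is the best approximation of `x` by elements of `P`. -/
theorem norm2_condExp_sub_le (x : N) (y : P) :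
    norm2 τ (inclCLM h (condExp hτ h x) - x) ≤ norm2 τ (inclCLM h y - x) := by
  set z := inclCLM h (condExp hτ h x) - x with hz
  -- `z` is orthogonal to `P`
  have horth : ∀ a : P, τ (star z * inclCLM h a) = 0 := by
    intro a
    rw [IsTrace.map_star_mul, hz, mul_sub, map_sub, ← inclCLM_star, ← restrict_mul_condExp hτ _ _ x,
      ← inclCLM_mul, restrict_apply, sub_self, map_zero]
  have h1 : τ (star z * z) = τ (star z * (inclCLM h y - x)) := by
    rw [mul_sub, map_sub, horth, zero_sub, hz, mul_sub, map_sub, ← hz, horth, zero_sub]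
  have h2 := norm_trace_star_mul_le τ z (inclCLM h y - x)
  rw [← h1, ← ofReal_norm2_sq, Complex.norm_real, Real.norm_of_nonneg (by positivity), pow_two]
    at h2
  rcases (norm2_nonneg τ z).eq_or_lt with h0 | h0
  · rw [← h0]
    exact norm2_nonneg _ _
  · exact le_of_mul_le_mul_left h2 h0

end

/-- The composition of completely positive maps. -/
noncomputable def cpComp {A B C : Type*} [CStarAlgebra A] [PartialOrder A] [StarOrderedRing A]
    [CStarAlgebra B] [PartialOrder B] [StarOrderedRing B]
    [CStarAlgebra C] [PartialOrder C] [StarOrderedRing C] (ψ : B →CP C) (φ : A →CP B) :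
    A →CP C where
  toLinearMap := ψ.toLinearMap ∘ₗ φ.toLinearMap
  map_cstarMatrix_nonneg' k Y hY :=
    ψ.map_cstarMatrix_nonneg' k _ (φ.map_cstarMatrix_nonneg' k Y hY)

/-- The inclusion of a von Neumann subalgebra is completely positive. -/
noncomputable def inclCP (h : P ≤ N) : P →CP N where
  toLinearMap := (inclCLM h).toLinearMap
  map_cstarMatrix_nonneg' k Y hY := by
    obtain ⟨Z, rfl⟩ := exists_eq_star_mul_self hY
    have h1 : (star Z * Z).map (inclCLM h) = star (Z.map (inclCLM h)) * Z.map (inclCLM h) := by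
      refine CStarMatrix.ext fun i j => ?_
      simp only [CStarMatrix.map_apply, CStarMatrix.mul_apply, CStarMatrix.star_apply, map_sum,
        inclCLM_mul, inclCLM_star]
    exact h1 ▸ star_mul_self_nonneg _

end CondExpMap

/-! ### Approximation by Haagerup subalgebras -/

section Approximation

variable {H : Type*} [NormedAddCommGroup H] [InnerProductSpace ℂ H] [CompleteSpace H]

/-- A subunital completely positive map which decreases the trace is a `‖·‖₂`-contraction. -/
theorem norm2_map_le {A B : VonNeumannAlgebra H} {σ : A →ₚ[ℂ] ℂ} {ρ : B →ₚ[ℂ] ℂ} (φ : A →CP B)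
    (h1 : φ 1 ≤ 1) (h2 : ∀ x : A, 0 ≤ x → ρ (φ x) ≤ σ x) (x : A) :
    norm2 ρ (φ x) ≤ norm2 σ x := by
  refine Real.sqrt_le_sqrt ?_
  have h3 : ρ (star (φ x) * φ x) ≤ σ (star x * x) :=
    (OrderHomClass.mono ρ (star_map_mul_map_le φ h1 x)).trans (h2 _ (star_mul_self_nonneg x))
  exact (Complex.le_def.mp h3).1

/-- The conditions which the definition of the Haagerup property imposes on each single one of the
approximating maps. -/
structure IsHaagerupMap {M : VonNeumannAlgebra H} (σ : M →ₚ[ℂ] ℂ) (φ : M →CP M) : Prop where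
  normal : IsNormalMap φ.toLinearMap
  map_one_le : φ 1 ≤ 1
  trace_le : ∀ x : M, 0 ≤ x → σ (φ x) ≤ σ x
  compact : ∃ T : σ.GNS →L[ℂ] σ.GNS, (∀ x : M, T (hat σ x) = hat σ (φ x)) ∧ IsCompactOperator T

theorem hasHaagerupProperty_iff {M : VonNeumannAlgebra H} {σ : M →ₚ[ℂ] ℂ} :
    HasHaagerupProperty M σ ↔ ∃ φ : ℕ → (M →CP M), (∀ n, IsHaagerupMap σ (φ n)) ∧
      ∀ x : M, Tendsto (fun n => norm2 σ (φ n x - x)) atTop (𝓝 0) :=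
  ⟨fun ⟨φ, h1, h2, h3, h4, h5⟩ => ⟨φ, fun n => ⟨h1 n, h2 n, h3 n, h4 n⟩, h5⟩,
    fun ⟨φ, h, h5⟩ => ⟨φ, fun n => (h n).normal, fun n => (h n).map_one_le,
      fun n => (h n).trace_le, fun n => (h n).compact, h5⟩⟩

/-- Since the maps in question are contractions for `‖·‖₂`, the Haagerup property can be checked
on finite subsets, as soon as `M` is separable for `‖·‖₂`. -/
theorem hasHaagerupProperty_of_finite {M : VonNeumannAlgebra H} {σ : M →ₚ[ℂ] ℂ}
    {D : ℕ → M} (hD : ∀ x : M, ∀ ε > 0, ∃ n, norm2 σ (D n - x) < ε)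
    (h : ∀ F : Set M, F.Finite → ∀ ε > 0, ∃ φ : M →CP M, IsHaagerupMap σ φ ∧
      ∀ x ∈ F, norm2 σ (φ x - x) < ε) : HasHaagerupProperty M σ := by
  choose φ hφ hφx using fun n : ℕ => h (D '' Set.Iic n) ((Set.finite_Iic n).image D)
    (1 / ((n : ℝ) + 1)) (by positivity)
  refine hasHaagerupProperty_iff.mpr ⟨φ, hφ, fun x => ?_⟩
  rw [Metric.tendsto_atTop]
  intro ε hε
  obtain ⟨k, hk⟩ := hD x (ε / 4) (by positivity)
  obtain ⟨m, hm⟩ := exists_nat_one_div_lt (show (0 : ℝ) < ε / 4 by positivity)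
  refine ⟨max k m, fun n hn => ?_⟩
  rw [Real.dist_0_eq_abs, abs_of_nonneg (norm2_nonneg _ _)]
  have h1 : norm2 σ (φ n (D k) - D k) < ε / 4 := by
    refine (hφx n (D k) ⟨k, (le_max_left _ _).trans hn, rfl⟩).trans_le (le_trans ?_ hm.le)
    have : (m : ℝ) ≤ n := by exact_mod_cast (le_max_right _ _).trans hn
    gcongr
  have h2 : norm2 σ (φ n x - φ n (D k)) < ε / 4 := by
    rw [← map_sub]
    refine (norm2_map_le _ (hφ n).map_one_le (hφ n).trace_le _).trans_lt ?_
    rwa [norm2_sub_comm]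
  have h3 := norm2_sub_le_add σ (φ n x) (φ n (D k)) x
  have h4 := norm2_sub_le_add σ (φ n (D k)) (D k) x
  linarith

section Compress

variable {M P N : VonNeumannAlgebra H} {τ : N →ₚ[ℂ] ℂ}

/-- The compression `E_M ∘ φ ∘ E_P` to `M` of a completely positive map `φ` on `P`. -/
noncomputable def compress (hτ : IsTrace N τ) (hM : M ≤ N) (hP : P ≤ N) (φ : P →CP P) : M →CP M :=
  cpComp (condExpCP hτ hM) (cpComp (inclCP hP) (cpComp φ (cpComp (condExpCP hτ hP) (inclCP hM))))

theorem compress_apply (hτ : IsTrace N τ) (hM : M ≤ N) (hP : P ≤ N) (φ : P →CP P) (x : M) :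
    compress hτ hM hP φ x = condExp hτ hM (inclCLM hP (φ (condExp hτ hP (inclCLM hM x)))) := rfl

theorem norm2_condExp_le (hτ : IsTrace N τ) (hM : M ≤ N) (x : N) :
    norm2 (restrict hM τ) (condExp hτ hM x) ≤ norm2 τ x :=
  norm2_map_le (condExpCP hτ hM) (condExp_one hτ hM).le
    (fun x _ => (trace_condExp hτ hM x).le) x

theorem IsHaagerupMap.compress (hτ : IsTrace N τ) (hM : M ≤ N) (hP : P ≤ N) {φ : P →CP P}
    (hφ : IsHaagerupMap (restrict hP τ) φ) :
    IsHaagerupMap (restrict hM τ) (compress hτ hM hP φ) where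
  normal ω hω := isNormalMap_incl hM _ (isNormalMap_condExp hτ hP _ (hφ.normal _
    (isNormalMap_incl hP _ (isNormalMap_condExp hτ hM ω hω))))
  map_one_le := by
    have h1 := condExp_nonneg hτ hM
      (show 0 ≤ 1 - inclCLM hP (φ 1) from sub_nonneg.mpr hφ.map_one_le)
    rw [map_sub, condExp_one, sub_nonneg] at h1
    rwa [compress_apply, inclCLM_one, condExp_one]
  trace_le x hx := by
    rw [compress_apply, trace_condExp]
    refine (hφ.trace_le _ (condExp_nonneg hτ hP (show 0 ≤ inclCLM hM x from hx))).trans ?_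
    rw [trace_condExp, restrict_apply]
  compact := by
    obtain ⟨T, hT, hTc⟩ := hφ.compact
    -- `L²(M) → L²(N) → L²(P) → L²(P) → L²(N) → L²(M)`, read from the right
    refine ⟨(inclL2 hM τ).adjoint ∘L inclL2 hP τ ∘L T ∘L (inclL2 hP τ).adjoint ∘L inclL2 hM τ,
      fun x => ?_, ?_⟩
    · simp only [ContinuousLinearMap.comp_apply, inclL2_hat, ← hat_condExp hτ, hT, compress_apply]
    · have h1 : IsCompactOperator (T ∘L (inclL2 hP τ).adjoint ∘L inclL2 hM τ) :=
        hTc.comp_clm ((inclL2 hP τ).adjoint ∘L inclL2 hM τ)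
      have h2 : IsCompactOperator (inclL2 hP τ ∘L T ∘L (inclL2 hP τ).adjoint ∘L inclL2 hM τ) :=
        h1.clm_comp (inclL2 hP τ)
      exact h2.clm_comp (inclL2 hM τ).adjoint

theorem norm2_compress_sub_le (hτ : IsTrace N τ) (hM : M ≤ N) (hP : P ≤ N) (φ : P →CP P) (x : M) :
    norm2 (restrict hM τ) (compress hτ hM hP φ x - x) ≤
      norm2 (restrict hP τ)
        (φ (condExp hτ hP (inclCLM hM x)) - condExp hτ hP (inclCLM hM x)) +
      norm2 τ (inclCLM hP (condExp hτ hP (inclCLM hM x)) - inclCLM hM x) := by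
  have h1 : compress hτ hM hP φ x - x = condExp hτ hM
      (inclCLM hP (φ (condExp hτ hP (inclCLM hM x))) - inclCLM hM x) := by
    rw [map_sub, condExp_inclCLM, compress_apply]
  rw [h1]
  refine (norm2_condExp_le hτ hM _).trans ?_
  exact norm2_sub_le_add τ _ (inclCLM hP (condExp hτ hP (inclCLM hM x))) _

end Compress

section Separable

variable {N : VonNeumannAlgebra H} {τ : N →ₚ[ℂ] ℂ}

/-- The normal functional `τ(· x)`. -/
noncomputable def traceMul (hτ : IsTrace N τ) (x : N) : predual N :=
  ⟨LinearMap.mkContinuous (τ.toLinearMap ∘ₗ LinearMap.mulRight ℂ x) (norm2 τ x) (fun y => by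
      have h1 := norm_trace_star_mul_le τ (star y) x
      rw [star_star] at h1
      have h2 := hτ.norm2_le_norm (star y)
      rw [norm_star] at h2
      refine h1.trans ?_
      rw [mul_comm]
      exact mul_le_mul_of_nonneg_left h2 (norm2_nonneg _ _)), by
    refine isNormalFunctional_iff.mpr fun y hy U hU hw => ?_
    refine hτ.normal.tendsto (f := fun z : N => z * x) (C := ‖x‖) ?_ ?_ (hw.mul_const x)
    · filter_upwards [hU] with z hz
      exact (norm_mul_le _ _).trans (mul_le_of_le_one_left (norm_nonneg _) hz)
    · exact (norm_mul_le _ _).trans (mul_le_of_le_one_left (norm_nonneg _) hy)⟩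

theorem traceMul_apply (hτ : IsTrace N τ) (x y : N) :
    (traceMul hτ x : StrongDual ℂ N) y = τ (y * x) := rfl

theorem traceMul_sub (hτ : IsTrace N τ) (x y : N) :
    traceMul hτ (x - y) = traceMul hτ x - traceMul hτ y := by
  refine Subtype.ext (ContinuousLinearMap.ext fun z => ?_)
  change τ (z * (x - y)) = τ (z * x) - τ (z * y)
  rw [mul_sub, map_sub]

/-- Evaluate `τ(· x)` at `x⋆`. -/
theorem norm2_sq_le_traceMul (hτ : IsTrace N τ) (x : N) :
    norm2 τ x ^ 2 ≤ ‖traceMul hτ x‖ * ‖x‖ := by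
  have h1 := (traceMul hτ x : StrongDual ℂ N).le_opNorm (star x)
  rw [traceMul_apply, ← ofReal_norm2_sq, Complex.norm_real, Real.norm_of_nonneg (by positivity),
    norm_star] at h1
  exact h1

/-- Each ball of `M` is separable for `‖·‖₂`, because `x ↦ τ(· x)` maps it to a subset of the
separable predual, and `‖x‖₂² ≤ ‖x‖ ‖τ(· x)‖`. -/
theorem exists_dense_seq (hN : HasSeparablePredual N) (hτ : IsTrace N τ)
    {M : VonNeumannAlgebra H} (hM : M ≤ N) :
    ∃ D : ℕ → M, ∀ x : M, ∀ ε > 0, ∃ n, norm2 (restrict hM τ) (D n - x) < ε := by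
  have : TopologicalSpace.SeparableSpace (predual N) := hN
  have hsep : ∀ n : ℕ, ∃ c : Set M, c.Countable ∧ (∀ d ∈ c, ‖d‖ ≤ n) ∧
      ∀ x : M, ‖x‖ ≤ n → ∀ δ : ℝ, 0 < δ → ∃ d ∈ c,
        ‖traceMul hτ (inclCLM hM (d - x))‖ < δ := by
    intro n
    have hs : TopologicalSpace.IsSeparable
        ((fun x : M => traceMul hτ (inclCLM hM x)) '' {x | ‖x‖ ≤ n}) :=
      TopologicalSpace.IsSeparable.of_separableSpace _
    obtain ⟨t, ht, htc, htd⟩ := hs.exists_countable_dense_subset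
    choose! g hg hgt using fun v (hv : v ∈ t) => ht hv
    refine ⟨g '' t, htc.image g, ?_, fun x hx δ hδ => ?_⟩
    · rintro _ ⟨v, hv, rfl⟩
      exact hg v hv
    · obtain ⟨v, hv, hvx⟩ := Metric.mem_closure_iff.mp (htd ⟨x, hx, rfl⟩) δ hδ
      exact ⟨g v, ⟨v, hv, rfl⟩, by
        have h1 : traceMul hτ (inclCLM hM (g v)) = v := hgt v hv
        rw [map_sub, traceMul_sub, h1]
        calc _ = dist v (traceMul hτ (inclCLM hM x)) :=
            (dist_eq_norm (v : StrongDual ℂ N) (traceMul hτ (inclCLM hM x))).symm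
          _ = dist (traceMul hτ (inclCLM hM x)) v := dist_comm _ _
          _ < δ := hvx⟩
  choose c hcc hcn hcd using hsep
  have hne : (⋃ n, c n).Nonempty := by
    obtain ⟨d, hd, -⟩ := hcd 0 0 (by simp) 1 one_pos
    exact ⟨d, Set.mem_iUnion.mpr ⟨0, hd⟩⟩
  obtain ⟨D, hD⟩ := (Set.countable_iUnion hcc).exists_eq_range hne
  refine ⟨D, fun x ε hε => ?_⟩
  obtain ⟨n, hn⟩ := exists_nat_ge ‖x‖
  obtain ⟨d, hd, hdx⟩ := hcd n x hn (ε ^ 2 / (2 * n + 1)) (by positivity)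
  obtain ⟨k, rfl⟩ : d ∈ Set.range D := hD ▸ Set.mem_iUnion.mpr ⟨n, hd⟩
  refine ⟨k, lt_of_pow_lt_pow_left₀ 2 hε.le ?_⟩
  rw [← norm2_inclCLM]
  refine (norm2_sq_le_traceMul hτ _).trans_lt ?_
  have h1 : ‖inclCLM hM (D k - x)‖ ≤ 2 * n := by
    refine (norm_sub_le (D k) x).trans ?_
    have := hcn n _ hd
    linarith
  have hpos : (0 : ℝ) < 2 * n + 1 := by positivity
  calc _ ≤ ‖traceMul hτ (inclCLM hM (D k - x))‖ * (2 * n) := by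
        gcongr
    _ ≤ ‖traceMul hτ (inclCLM hM (D k - x))‖ * (2 * n + 1) := by
        gcongr
        linarith
    _ < ε ^ 2 / (2 * n + 1) * (2 * n + 1) := by gcongr
    _ = ε ^ 2 := by field_simp

end Separable

/-- The elements of `N` which can be approximated in `‖·‖₂` by elements of the members of a
filter on the set of von Neumann subalgebras. -/
noncomputable def approxSubmodule {N : VonNeumannAlgebra H} (τ : N →ₚ[ℂ] ℂ) (l : Filter (SA N)) :
    Submodule ℂ N where
  carrier := {x | ∀ ε : ℝ, 0 < ε → ∀ᶠ P in l, ∃ y ∈ SA.toSet P, norm2 τ (y - x) < ε}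
  zero_mem' ε hε := Eventually.of_forall fun P => ⟨0, zero_mem P.1, by simpa [norm2] using hε⟩
  add_mem' {x y} hx hy ε hε := by
    filter_upwards [hx _ (half_pos hε), hy _ (half_pos hε)] with P ⟨a, ha, hax⟩ ⟨b, hb, hby⟩
    refine ⟨a + b, add_mem (s := P.1) ha hb, ?_⟩
    rw [add_sub_add_comm]
    linarith [norm2_add_le τ (a - x) (b - y)]
  smul_mem' c x hx ε hε := by
    filter_upwards [hx (ε / (‖c‖ + 1)) (by positivity)] with P ⟨a, ha, hax⟩
    refine ⟨c • a, SMulMemClass.smul_mem (s := P.1) c ha, ?_⟩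
    rw [← smul_sub, norm2_smul]
    calc _ ≤ (‖c‖ + 1) * norm2 τ (a - x) := by
          have := norm2_nonneg τ (a - x)
          gcongr
          linarith
      _ < (‖c‖ + 1) * (ε / (‖c‖ + 1)) := by gcongr
      _ = ε := by field_simp

theorem mem_approxSubmodule_of_forall {N : VonNeumannAlgebra H} {τ : N →ₚ[ℂ] ℂ}
    {l : Filter (SA N)} {x : N}
    (h : ∀ ε : ℝ, 0 < ε → ∃ z ∈ approxSubmodule τ l, norm2 τ (z - x) < ε) :
    x ∈ approxSubmodule τ l := by
  intro ε hε
  obtain ⟨z, hz, hzx⟩ := h _ (half_pos hε)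
  filter_upwards [hz _ (half_pos hε)] with P ⟨y, hy, hyz⟩
  exact ⟨y, hy, by linarith [norm2_sub_le_add τ y z x]⟩

/-- If every element of `M` can be approximated in `‖·‖₂` by elements of Haagerup subalgebras,
then `M` is a Haagerup subalgebra. -/
theorem mem_HAP_of_approx {N : VonNeumannAlgebra H} (hN : HasSeparablePredual N)
    {τ : N →ₚ[ℂ] ℂ} (hτ : IsTrace N τ) {l : Filter (SA N)} [l.NeBot]
    (hl : ∀ᶠ P in l, P ∈ HAP N τ) {M : SA N}
    (hM : M.toSet ⊆ approxSubmodule τ l) :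
    M ∈ HAP N τ := by
  obtain ⟨D, hD⟩ := exists_dense_seq hN hτ M.2
  refine hasHaagerupProperty_of_finite hD fun F hF ε hε => ?_
  have h1 : ∀ᶠ P in l, ∀ x ∈ F, ∃ y ∈ SA.toSet P, norm2 τ (y - inclCLM M.2 x) < ε / 2 :=
    (eventually_all_finite hF).mpr fun x _ => hM (a := inclCLM M.2 x) x.2 (ε / 2) (by positivity)
  obtain ⟨P, hP, hPx⟩ := (hl.and h1).exists
  obtain ⟨φ, hφ, hφx⟩ := hasHaagerupProperty_iff.mp hP
  have h2 : ∀ᶠ n in atTop, ∀ x ∈ F, norm2 (restrict P.2 τ)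
      (φ n (condExp hτ P.2 (inclCLM M.2 x)) - condExp hτ P.2 (inclCLM M.2 x)) < ε / 2 :=
    (eventually_all_finite hF).mpr fun x _ => (hφx _).eventually_lt_const (by positivity)
  obtain ⟨n, hn⟩ := h2.exists
  refine ⟨compress hτ M.2 P.2 (φ n), (hφ n).compress hτ M.2 P.2, fun x hx => ?_⟩
  obtain ⟨y, hy, hyx⟩ := hPx x hx
  have h3 := norm2_compress_sub_le hτ M.2 P.2 (φ n) x
  have h4 := norm2_condExp_sub_le hτ P.2 (inclCLM M.2 x) ⟨(y : H →L[ℂ] H), hy⟩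
  have h5 : inclCLM P.2 ⟨(y : H →L[ℂ] H), hy⟩ = y := rfl
  rw [h5] at h4
  linarith [hn x hx]

/-- A von Neumann algebra contained in the inferior limit of a net of Haagerup subalgebras is a
Haagerup subalgebra. -/
theorem mem_HAP_of_subset_emLiminf {N : VonNeumannAlgebra H} (hN : HasSeparablePredual N)
    {τ : N →ₚ[ℂ] ℂ} (hτ : IsTrace N τ) {ι : Type*} [Preorder ι] [IsDirectedOrder ι] [Nonempty ι]
    {Mi : ι → SA N} {M : SA N} (hMi : ∀ i, Mi i ∈ HAP N τ) (hM : M.toSet ⊆ emLiminf τ Mi) :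
    M ∈ HAP N τ := by
  refine mem_HAP_of_approx hN hτ (l := map Mi atTop)
    (eventually_map.mpr (Eventually.of_forall hMi)) fun x hx ε hε => ?_
  obtain ⟨y, hy, hyx⟩ := hM hx
  exact (hyx.eventually_lt_const hε).mono fun i hi => ⟨y i, hy.1 i, hi⟩

end Approximation

/-! ### The Effros–Maréchal topology -/

section Topology

variable {H : Type*} [NormedAddCommGroup H] [InnerProductSpace ℂ H] [CompleteSpace H]
  {N : VonNeumannAlgebra H} {τ : N →ₚ[ℂ] ℂ}

/-- Pythagoras, for the orthogonal projection `E_P x` of `x`. -/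
theorem norm2_condExp_sub_sq (hτ : IsTrace N τ) {P : VonNeumannAlgebra H} (h : P ≤ N) (x : N) :
    norm2 τ (inclCLM h (condExp hτ h x) - x) ^ 2
      = norm2 τ x ^ 2 - norm2 (restrict h τ) (condExp hτ h x) ^ 2 := by
  have h1 : ⟪hat τ (inclCLM h (condExp hτ h x)), hat τ x⟫_ℂ
      = ((norm2 (restrict h τ) (condExp hτ h x) ^ 2 : ℝ) : ℂ) := by
    rw [inner_hat, ← inclCLM_star, ← restrict_mul_condExp hτ, ofReal_norm2_sq]
  rw [← norm_hat, hat_sub, norm_sub_sq (𝕜 := ℂ), h1, norm_hat, norm_hat, norm2_inclCLM]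
  simp only [RCLike.re_to_complex, Complex.ofReal_re]
  ring

theorem norm_traceMul_star_comp_le (hτ : IsTrace N τ) {P : VonNeumannAlgebra H} (h : P ≤ N)
    (x : N) : ‖(traceMul hτ (star x) : StrongDual ℂ N).comp (inclCLM h)‖ ≤
      norm2 (restrict h τ) (condExp hτ h x) := by
  refine ContinuousLinearMap.opNorm_le_bound _ (norm2_nonneg _ _) fun y => ?_
  have h1 : τ (inclCLM h y * star x) = (starRingEnd ℂ)
      (restrict h τ (star y * condExp hτ h x)) := by
    rw [restrict_mul_condExp, hτ.map_mul_comm, IsTrace.map_star_mul, inclCLM_star]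
  rw [ContinuousLinearMap.comp_apply, traceMul_apply, h1, RCLike.norm_conj, mul_comm]
  refine (norm_trace_star_mul_le _ _ _).trans ?_
  exact mul_le_mul_of_nonneg_right ((hτ.restrict h).norm2_le_norm y) (norm2_nonneg _ _)

theorem one_le_norm_traceMul_star_comp (hτ : IsTrace N τ) {M : VonNeumannAlgebra H} (h : M ≤ N)
    {u : M} (hu : u ∈ unitary M) :
    1 ≤ ‖(traceMul hτ (star (inclCLM h u)) : StrongDual ℂ N).comp (inclCLM h)‖ := by
  have h1 := ((traceMul hτ (star (inclCLM h u)) : StrongDual ℂ N).comp (inclCLM h)).le_opNorm u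
  rw [ContinuousLinearMap.comp_apply, traceMul_apply, ← inclCLM_star, ← inclCLM_mul,
    Unitary.mul_star_self_of_mem hu, inclCLM_one, hτ.map_one, norm_one] at h1
  have h2 : ‖u‖ ≤ 1 := by
    have h3 := CStarRing.norm_star_mul_self (x := u)
    rw [Unitary.star_mul_self_of_mem hu] at h3
    nlinarith [norm_one_le_one M, norm_nonneg u]
  exact h1.trans (mul_le_of_le_one_right (norm_nonneg _) h2)

theorem continuous_norm_comp_inclCLM (ω : predual N) :
    Continuous[effrosMarechal N, inferInstance]
      fun M : SA N => ‖(ω : StrongDual ℂ N).comp (inclCLM M.2)‖ :=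
  continuous_iInf_dom (i := ω) continuous_induced_dom

/-- A unitary `u` of `M` can be approximated in all subalgebras `P` near `M`, because
`‖τ(· u⋆)|_M‖ = 1`, whereas `‖τ(· u⋆)|_P‖ ≤ ‖E_P(u)‖₂` and
`‖E_P(u) - u‖₂² = 1 - ‖E_P(u)‖₂²`. -/
theorem eventually_approx_unitary (hτ : IsTrace N τ) (M : SA N) {u : M.1}
    (hu : u ∈ unitary M.1) {ε : ℝ} (hε : 0 < ε) :
    ∀ᶠ P in @nhds _ (effrosMarechal N) M,
      ∃ y ∈ SA.toSet P, norm2 τ (y - inclCLM M.2 u) < ε := by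
  let _ := effrosMarechal N
  -- small enough for `1 - (1 - δ)² ≤ 2 δ < ε²`
  set δ : ℝ := min 1 (ε ^ 2 / 4) with hδ
  have hδ0 : 0 < δ := by positivity
  have hδ1 : δ ≤ 1 := min_le_left _ _
  have hδ2 : δ ≤ ε ^ 2 / 4 := min_le_right _ _
  have h1 : 1 - δ < ‖(traceMul hτ (star (inclCLM M.2 u)) : StrongDual ℂ N).comp
      (inclCLM M.2)‖ := by
    linarith [one_le_norm_traceMul_star_comp hτ M.2 hu]
  filter_upwards [(continuous_norm_comp_inclCLM _).continuousAt.eventually_const_lt h1] with P hP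
  refine ⟨inclCLM P.2 (condExp hτ P.2 (inclCLM M.2 u)), (condExp hτ P.2 _).2,
    lt_of_pow_lt_pow_left₀ 2 hε.le ?_⟩
  rw [norm2_condExp_sub_sq]
  have h2 := hP.trans_le (norm_traceMul_star_comp_le hτ P.2 _)
  have h3 : norm2 τ (inclCLM M.2 u) ^ 2 = 1 := by
    rw [norm2_sq, ← inclCLM_star, ← inclCLM_mul, Unitary.star_mul_self_of_mem hu, inclCLM_one,
      hτ.map_one, Complex.one_re]
  rw [h3]
  nlinarith [sq_nonneg δ]

/-- Unitaries suffice for the approximation, because they span a C⋆-algebra. -/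
theorem isClosed_HAP (hN : HasSeparablePredual N) (hτ : IsTrace N τ) :
    IsClosed[effrosMarechal N] (HAP N τ) := by
  let _ := effrosMarechal N
  refine isClosed_of_closure_subset fun M hM => ?_
  have := mem_closure_iff_nhdsWithin_neBot.mp hM
  refine mem_HAP_of_approx hN hτ (l := 𝓝[HAP N τ] M) self_mem_nhdsWithin fun x hx => ?_
  have hspan : Submodule.span ℂ (unitary M.1 : Set M.1) ≤
      (approxSubmodule τ (𝓝[HAP N τ] M)).comap (inclCLM M.2).toLinearMap :=
    Submodule.span_le.mpr fun u hu ε hε =>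
      (eventually_approx_unitary hτ M hu hε).filter_mono nhdsWithin_le_nhds
  rw [CStarAlgebra.span_unitary] at hspan
  exact hspan (x := ⟨(x : H →L[ℂ] H), hx⟩) trivial

end Topology

/-! ### Density in the double commutant -/

section DoubleCommutant

variable {H : Type*} [NormedAddCommGroup H] [InnerProductSpace ℂ H] [CompleteSpace H]

/-- The diagonal action of an operator on a finite direct sum of copies of `H`. -/
noncomputable def diagCLM {ι : Type*} [Fintype ι] (T : H →L[ℂ] H) :
    PiLp 2 (fun _ : ι => H) →L[ℂ] PiLp 2 (fun _ : ι => H) :=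
  (PiLp.continuousLinearEquiv 2 ℂ (fun _ : ι => H)).symm.toContinuousLinearMap ∘L
    ContinuousLinearMap.pi (fun i => T ∘L ContinuousLinearMap.proj i) ∘L
      (PiLp.continuousLinearEquiv 2 ℂ (fun _ : ι => H)).toContinuousLinearMap

omit [CompleteSpace H] in
theorem diagCLM_apply {ι : Type*} [Fintype ι] (T : H →L[ℂ] H) (v : PiLp 2 (fun _ : ι => H))
    (i : ι) : diagCLM T v i = T (v i) := rfl

theorem inner_diagCLM_star {ι : Type*} [Fintype ι] (T : H →L[ℂ] H)
    (v w : PiLp 2 (fun _ : ι => H)) : ⟪diagCLM T v, w⟫_ℂ = ⟪v, diagCLM (star T) w⟫_ℂ := by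
  simp only [PiLp.inner_apply, diagCLM_apply, ContinuousLinearMap.star_eq_adjoint,
    ContinuousLinearMap.adjoint_inner_right]

/-- The density part of von Neumann's double commutant theorem: an operator in the double
commutant of `A` can be approximated by elements of `A` on finitely many vectors. The projection
onto the closure of `{(a η i)_i | a ∈ A}` commutes with the diagonal action of `A`, so that its
matrix entries belong to the commutant of `A`. -/
theorem exists_seq_tendsto_of_mem_centralizer_centralizer (A : StarSubalgebra ℂ (H →L[ℂ] H))
    {w : H →L[ℂ] H} (hw : w ∈ Set.centralizer (Set.centralizer (A : Set (H →L[ℂ] H))))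
    {ι : Type*} [Fintype ι] (η : ι → H) :
    ∃ a : ℕ → H →L[ℂ] H, (∀ n, a n ∈ A) ∧
      ∀ i, Tendsto (fun n => a n (η i)) atTop (𝓝 (w (η i))) := by
  classical
  let ev : (H →L[ℂ] H) →ₗ[ℂ] PiLp 2 (fun _ : ι => H) :=
    { toFun := fun T => diagCLM T (WithLp.toLp 2 η)
      map_add' := fun _ _ => rfl
      map_smul' := fun _ _ => rfl }
  let S₀ : Submodule ℂ (PiLp 2 (fun _ : ι => H)) :=
    (Subalgebra.toSubmodule A.toSubalgebra).map ev
  let S := S₀.topologicalClosure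
  have hS : ∀ a ∈ A, ∀ v ∈ S, diagCLM a v ∈ S := by
    intro a ha v hv
    refine map_mem_closure (diagCLM a).continuous hv ?_
    rintro _ ⟨b, hb, rfl⟩
    exact ⟨a * b, A.mul_mem ha hb, rfl⟩
  have hcomm : ∀ a ∈ A, ∀ v, S.starProjection (diagCLM a v) = diagCLM a (S.starProjection v) := by
    intro a ha v
    refine Submodule.eq_starProjection_of_mem_of_inner_eq_zero (hS a ha _
      (S.starProjection_apply_mem v)) fun s hs => ?_
    rw [← map_sub, inner_diagCLM_star, S.starProjection_inner_eq_zero _ _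
      (hS _ (star_mem ha) s hs)]
  -- the embeddings of the summands, and the matrix entries of the projection
  let J : ι → H →L[ℂ] PiLp 2 (fun _ : ι => H) := fun j =>
    (PiLp.continuousLinearEquiv 2 ℂ (fun _ : ι => H)).symm.toContinuousLinearMap ∘L
      ContinuousLinearMap.single ℂ (fun _ => H) j
  have hJ : ∀ v : PiLp 2 (fun _ : ι => H), ∑ j, J j (v j) = v := fun v => by
    ext i
    simp [J, Pi.single_apply]
  have hJd : ∀ (T : H →L[ℂ] H) j x, diagCLM T (J j x) = J j (T x) := fun T j x => by
    ext i
    by_cases hij : i = j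
    · subst hij
      simp [J, diagCLM_apply]
    · simp [J, diagCLM_apply, hij]
  let q : ι → ι → H →L[ℂ] H := fun i j =>
    PiLp.proj 2 (𝕜 := ℂ) (fun _ : ι => H) i ∘L S.starProjection ∘L J j
  have hq_apply : ∀ i j x, q i j x = (S.starProjection (J j x)) i := fun _ _ _ => rfl
  have hq : ∀ i j, w * q i j = q i j * w := by
    intro i j
    refine (Set.mem_centralizer_iff.mp hw (q i j) (Set.mem_centralizer_iff.mpr fun a ha => ?_)).symm
    ext x
    change a (q i j x) = q i j (a x)
    rw [hq_apply, hq_apply, ← hJd, hcomm a ha, diagCLM_apply]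
  have hη : (WithLp.toLp 2 η : PiLp 2 (fun _ : ι => H)) ∈ S :=
    S₀.le_topologicalClosure ⟨1, A.one_mem, rfl⟩
  have hproj : S.starProjection (diagCLM w (WithLp.toLp 2 η)) = diagCLM w (WithLp.toLp 2 η) := by
    conv_lhs => rw [← hJ (WithLp.toLp 2 η)]
    ext i
    rw [map_sum, map_sum]
    simp only [hJd, WithLp.ofLp_sum, Finset.sum_apply]
    have h1 : ∀ j, (S.starProjection (J j (w (η j)))) i = w (q i j (η j)) := fun j =>
      (DFunLike.congr_fun (hq i j) (η j)).symm
    simp only [h1]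
    rw [← map_sum, diagCLM_apply]
    congr 1
    simp only [hq_apply]
    have h2 := congrArg (fun v => S.starProjection v i) (hJ (WithLp.toLp 2 η))
    simp only [map_sum, WithLp.ofLp_sum, Finset.sum_apply] at h2
    rw [h2, Submodule.starProjection_eq_self_iff.mpr hη]
  have hmem : diagCLM w (WithLp.toLp 2 η) ∈ closure (S₀ : Set (PiLp 2 (fun _ : ι => H))) := by
    have h1 := S.starProjection_apply_mem (diagCLM w (WithLp.toLp 2 η))
    rwa [hproj] at h1
  obtain ⟨v, hv, hvw⟩ := mem_closure_iff_seq_limit.mp hmem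
  choose a ha hav using hv
  refine ⟨a, ha, fun i => ?_⟩
  have h1 := ((PiLp.proj 2 (𝕜 := ℂ) (fun _ : ι => H) i).continuous.tendsto _).comp hvw
  refine h1.congr fun n => ?_
  rw [Function.comp_apply, ← hav n]
  rfl

/-- A self-adjoint operator in the double commutant of `A` can be approximated by self-adjoint
elements of `A` on finitely many vectors. By the Hahn–Banach theorem, it is enough to approximate
matrix coefficients. -/
theorem exists_seq_tendsto_of_isSelfAdjoint (A : StarSubalgebra ℂ (H →L[ℂ] H))
    {w : H →L[ℂ] H} (hw : w ∈ Set.centralizer (Set.centralizer (A : Set (H →L[ℂ] H))))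
    (hws : IsSelfAdjoint w) {ι : Type*} [Fintype ι] (η : ι → H) :
    ∃ a : ℕ → H →L[ℂ] H, (∀ n, a n ∈ A ∧ IsSelfAdjoint (a n)) ∧
      ∀ i, Tendsto (fun n => a n (η i)) atTop (𝓝 (w (η i))) := by
  classical
  set s : Set (ι → H) := (fun T : H →L[ℂ] H => fun i => T (η i)) '' {a | a ∈ A ∧ IsSelfAdjoint a}
    with hs
  have hreal : ∀ r : ℝ, IsSelfAdjoint (r : ℂ) := fun r => Complex.conj_ofReal r
  have hconv : Convex ℝ s := by
    rintro _ ⟨a, ⟨ha, has⟩, rfl⟩ _ ⟨b, ⟨hb, hbs⟩, rfl⟩ r t - - -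
    refine ⟨(r : ℂ) • a + (t : ℂ) • b, ⟨A.add_mem (A.smul_mem ha _) (A.smul_mem hb _), ?_⟩, rfl⟩
    exact ((hreal r).smul has).add ((hreal t).smul hbs)
  have hmem : (fun i => w (η i)) ∈ closure s := by
    by_contra hnot
    obtain ⟨f, u, hfu, huf⟩ := RCLike.geometric_hahn_banach_closed_point (𝕜 := ℂ) hconv.closure
      isClosed_closure hnot
    let ζ : ι → H := fun i => (InnerProductSpace.toDual ℂ H).symm
      (f ∘L ContinuousLinearMap.single ℂ (fun _ => H) i)
    have hf : ∀ v : ι → H, f v = ∑ i, ⟪ζ i, v i⟫_ℂ := fun v => by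
      have h1 : v = ∑ i, Pi.single i (v i) := (Finset.univ_sum_single v).symm
      conv_lhs => rw [h1, map_sum]
      refine Finset.sum_congr rfl fun i _ => ?_
      rw [InnerProductSpace.toDual_symm_apply]
      rfl
    obtain ⟨a, ha, ha_lim⟩ := exists_seq_tendsto_of_mem_centralizer_centralizer A hw (Sum.elim η ζ)
    -- the coefficients of the real parts of `a n` converge, since `w` is self-adjoint
    have h1 : Tendsto (fun n => ∑ i, (1 / 2 : ℂ) * (⟪ζ i, a n (η i)⟫_ℂ + ⟪a n (ζ i), η i⟫_ℂ)) atTop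
        (𝓝 (∑ i, (1 / 2 : ℂ) * (⟪ζ i, w (η i)⟫_ℂ + ⟪w (ζ i), η i⟫_ℂ))) :=
      tendsto_finsetSum _ fun i _ => ((tendsto_const_nhds.inner (ha_lim (Sum.inl i))).add
        ((ha_lim (Sum.inr i)).inner tendsto_const_nhds)).const_mul _
    have h2 : ∑ i, (1 / 2 : ℂ) * (⟪ζ i, w (η i)⟫_ℂ + ⟪w (ζ i), η i⟫_ℂ) = f fun i => w (η i) := by
      rw [hf]
      refine Finset.sum_congr rfl fun i _ => ?_
      have : ⟪w (ζ i), η i⟫_ℂ = ⟪ζ i, w (η i)⟫_ℂ := by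
        rw [← ContinuousLinearMap.adjoint_inner_right, ← ContinuousLinearMap.star_eq_adjoint,
          hws.star_eq]
      rw [this]
      ring
    have h3 : ∀ n, ∑ i, (1 / 2 : ℂ) * (⟪ζ i, a n (η i)⟫_ℂ + ⟪a n (ζ i), η i⟫_ℂ)
        = f fun i => ((1 / 2 : ℂ) • (a n + star (a n))) (η i) := by
      intro n
      rw [hf]
      refine Finset.sum_congr rfl fun i _ => ?_
      rw [smul_apply, add_apply, inner_smul_right,
        inner_add_right, ContinuousLinearMap.star_eq_adjoint,
        ContinuousLinearMap.adjoint_inner_right]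
    have h4 : ∀ n, RCLike.re (f fun i => ((1 / 2 : ℂ) • (a n + star (a n))) (η i)) ≤ u := by
      intro n
      have hmem : (1 / 2 : ℂ) • (a n + star (a n)) ∈ A :=
        SMulMemClass.smul_mem _ (add_mem (ha n) (star_mem (ha n)))
      have hsa : IsSelfAdjoint (1 / 2 : ℂ) := by simp [isSelfAdjoint_iff]
      exact (hfu _ (subset_closure ⟨_, ⟨hmem, hsa.smul (IsSelfAdjoint.add_star_self _)⟩, rfl⟩)).le
    rw [h2] at h1
    have h5 := le_of_tendsto' ((RCLike.continuous_re.tendsto _).comp h1) fun n => by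
      rw [Function.comp_apply, h3]
      exact h4 n
    linarith
  obtain ⟨v, hv, hvw⟩ := mem_closure_iff_seq_limit.mp hmem
  choose a ha hav using hv
  refine ⟨a, ha, fun i => (tendsto_pi_nhds.mp hvw i).congr fun n => ?_⟩
  rw [← hav n]

end DoubleCommutant

/-! ### Chains of subalgebras and maximal elements -/

section Maximal

/-- The resolvent `(1 + i t b)⁻¹` of a self-adjoint element exists and is a contraction. -/
theorem exists_resolvent {A : Type*} [CStarAlgebra A] {b : A} (hb : IsSelfAdjoint b) (t : ℝ) :
    ∃ r : A, r * (1 + (t * Complex.I : ℂ) • b) = 1 ∧ (1 + (t * Complex.I : ℂ) • b) * r = 1 ∧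
      ‖r‖ ≤ 1 := by
  have hre : ∀ z ∈ spectrum ℂ b, 1 ≤ ‖1 + (t * Complex.I : ℂ) * z‖ := by
    intro z hz
    rw [hb.mem_spectrum_eq_re hz]
    refine le_trans (le_of_eq ?_) (Complex.abs_re_le_norm _)
    simp
  have hne : ∀ z ∈ spectrum ℂ b, 1 + (t * Complex.I : ℂ) * z ≠ 0 := fun z hz h0 => by
    have := hre z hz
    rw [h0, norm_zero] at this
    linarith
  have hc : ContinuousOn (fun z : ℂ => (1 + (t * Complex.I : ℂ) * z)⁻¹) (spectrum ℂ b) :=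
    ContinuousOn.inv₀ (by fun_prop) hne
  have hbn : IsStarNormal b := hb.isStarNormal
  have h1 : 1 + (t * Complex.I : ℂ) • b = cfc (fun z : ℂ => 1 + (t * Complex.I : ℂ) * z) b := by
    rw [cfc_const_add 1 (fun z : ℂ => (t * Complex.I : ℂ) * z) b (by fun_prop),
      cfc_const_mul_id _ b, map_one]
  refine ⟨cfc (fun z : ℂ => (1 + (t * Complex.I : ℂ) * z)⁻¹) b, ?_, ?_, ?_⟩
  · rw [h1, ← cfc_mul _ _ b hc (by fun_prop), ← cfc_one ℂ b]
    exact cfc_congr fun z hz => inv_mul_cancel₀ (hne z hz)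
  · rw [h1, ← cfc_mul _ _ b (by fun_prop) hc, ← cfc_one ℂ b]
    exact cfc_congr fun z hz => mul_inv_cancel₀ (hne z hz)
  · refine norm_cfc_le zero_le_one fun z hz => ?_
    rw [norm_inv]
    exact inv_le_one_of_one_le₀ (hre z hz)

variable {H : Type*} [NormedAddCommGroup H] [InnerProductSpace ℂ H] [CompleteSpace H]
  {N : VonNeumannAlgebra H} {τ : N →ₚ[ℂ] ℂ}

/-- The norm `‖·‖₂` is strongly continuous on bounded sets. -/
theorem tendsto_norm2_of_tendsto (hτ : IsTrace N τ) {ι : Type*} {l : Filter ι} {y : ι → N} {r : N}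
    {C : ℝ} (hy : ∀ i, ‖y i - r‖ ≤ C)
    (h : ∀ ξ : H, Tendsto (fun i => ((y i - r : N) : H →L[ℂ] H) ξ) l (𝓝 0)) :
    Tendsto (fun i => norm2 τ (y i - r)) l (𝓝 0) := by
  have hw : WTendsto (fun i => star (y i - r) * (y i - r)) l 0 := by
    intro ξ η
    have h1 := (h ξ).inner (𝕜 := ℂ) (h η)
    rw [inner_zero_left] at h1
    change Tendsto _ _ (𝓝 ⟪ξ, (0 : H →L[ℂ] H) η⟫_ℂ)
    rw [zero_apply, inner_zero_right]
    refine h1.congr fun i => ?_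
    rw [← ContinuousLinearMap.adjoint_inner_right]
    rfl
  have h2 := hτ.normal.tendsto (C := C * C) (Eventually.of_forall fun i => by
    rw [CStarRing.norm_star_mul_self]
    exact mul_self_le_mul_self (norm_nonneg _) (hy i)) (by
    rw [norm_zero]; exact mul_self_nonneg C) hw
  have h3 := (Real.continuous_sqrt.tendsto _).comp ((Complex.continuous_re.tendsto _).comp h2)
  simpa [Function.comp_def, norm2] using! h3

/-- Let `A` be the union of a family `c` of von Neumann subalgebras of `N`. The elements of the
double commutant of `A` are limits in `‖·‖₂` of elements of `A`. For a self-adjoint `w` this is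
shown with the resolvents `(1 + i t w)⁻¹`: they are strong limits of resolvents of self-adjoint
elements of `A`, which are bounded, and `(i t)⁻¹ (1 - (1 + i t w)⁻¹)` converges in norm to `w`
for `t → 0`. -/
theorem mem_approxSubmodule_of_isSelfAdjoint (hτ : IsTrace N τ) {c : Set (SA N)}
    {A : StarSubalgebra ℂ (H →L[ℂ] H)} (hA : ∀ x, x ∈ A ↔ ∃ P ∈ c, x ∈ P.1)
    {l : Filter (SA N)} (hl : ∀ P ∈ c, ∀ᶠ Q in l, P ≤ Q) {w : N}
    (hw : (w : H →L[ℂ] H) ∈ Set.centralizer (Set.centralizer (A : Set (H →L[ℂ] H))))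
    (hws : IsSelfAdjoint w) : w ∈ approxSubmodule τ l := by
  classical
  have hone : (1 : N) ∈ approxSubmodule τ l := fun ε hε =>
    Eventually.of_forall fun P => ⟨1, one_mem P.1, by simpa [norm2] using hε⟩
  have hres : ∀ (t : ℝ) (r : N), r * (1 + (t * Complex.I : ℂ) • w) = 1 →
      (1 + (t * Complex.I : ℂ) • w) * r = 1 → ‖r‖ ≤ 1 → r ∈ approxSubmodule τ l := by
    intro t r hr1 hr2 hr
    have hy : ∀ i : Finset H × ℕ, ∃ y : N, (y : H →L[ℂ] H) ∈ A ∧ ‖y‖ ≤ 1 ∧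
        ∀ ξ ∈ i.1, ‖((y - r : N) : H →L[ℂ] H) ξ‖ ≤ 1 / ((i.2 : ℝ) + 1) := by
      rintro ⟨F, n⟩
      obtain ⟨b, hb, hbw⟩ := exists_seq_tendsto_of_isSelfAdjoint A hw
        (congrArg (fun x : N => (x : H →L[ℂ] H)) hws) (fun ξ : F => (r : H →L[ℂ] H) ξ)
      have hev : ∀ᶠ k in atTop, ∀ ξ : F, ‖(t * Complex.I : ℂ) •
          ((w : H →L[ℂ] H) ((r : H →L[ℂ] H) ξ) - b k ((r : H →L[ℂ] H) ξ))‖ < 1 / ((n : ℝ) + 1) := by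
        refine eventually_all.mpr fun ξ => ?_
        have h1 := ((tendsto_const_nhds (x := (w : H →L[ℂ] H) ((r : H →L[ℂ] H) ξ))).sub
          (hbw ξ)).const_smul (t * Complex.I : ℂ) |>.norm
        rw [sub_self, smul_zero, norm_zero] at h1
        exact h1.eventually_lt_const (by positivity)
      obtain ⟨k, hk⟩ := hev.exists
      obtain ⟨P, hP, hbP⟩ := (hA _).mp (hb k).1
      obtain ⟨s, hs1, hs2, hs⟩ := exists_resolvent (A := P.1) (b := ⟨b k, hbP⟩)
        (Subtype.ext (hb k).2) t
      refine ⟨inclCLM P.2 s, (hA _).mpr ⟨P, hP, s.2⟩, hs, fun ξ hξ => ?_⟩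
      -- the resolvent identity
      have h2 : inclCLM P.2 s - r = inclCLM P.2 s *
          ((t * Complex.I : ℂ) • (w * r - inclCLM P.2 ⟨b k, hbP⟩ * r)) := by
        have h3 := congrArg (inclCLM P.2) hs1
        rw [inclCLM_mul, map_add, map_smul, inclCLM_one] at h3
        calc inclCLM P.2 s - r = inclCLM P.2 s * ((1 + (t * Complex.I : ℂ) • w) * r) -
              inclCLM P.2 s * (1 + (t * Complex.I : ℂ) • inclCLM P.2 ⟨b k, hbP⟩) * r := by
              rw [hr2, h3, mul_one, one_mul]
          _ = _ := by
              rw [mul_assoc, ← mul_sub, add_mul, add_mul, add_sub_add_left_eq_sub, smul_mul_assoc,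
                smul_mul_assoc, smul_sub]
      rw [h2]
      refine le_trans ?_ (hk ⟨ξ, hξ⟩).le
      refine ((s : H →L[ℂ] H).le_opNorm _).trans ?_
      exact mul_le_of_le_one_left (norm_nonneg _) hs
    -- the net `y`, indexed by finite sets of vectors and error bounds, converges strongly to `r`
    choose y hyA hy1 hyF using hy
    have hyr : ∀ i, ‖y i - r‖ ≤ 1 + 1 := fun i => (norm_sub_le _ _).trans (add_le_add (hy1 i) hr)
    have hlim := tendsto_norm2_of_tendsto hτ (l := atTop) hyr fun ξ => by
      rw [tendsto_zero_iff_norm_tendsto_zero, Metric.tendsto_atTop]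
      intro ε hε
      obtain ⟨m, hm⟩ := exists_nat_one_div_lt hε
      refine ⟨({ξ}, m), fun i hi => ?_⟩
      rw [Real.dist_0_eq_abs, abs_norm]
      refine (hyF i ξ (hi.1 (Finset.mem_singleton_self ξ))).trans_lt (lt_of_le_of_lt ?_ hm)
      have : (m : ℝ) ≤ i.2 := by exact_mod_cast hi.2
      gcongr
    intro ε hε
    obtain ⟨i, hi⟩ := (hlim.eventually_lt_const hε).exists
    obtain ⟨P, hP, hyP⟩ := (hA _).mp (hyA i)
    filter_upwards [hl P hP] with Q hQ
    exact ⟨y i, hQ hyP, hi⟩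
  refine mem_approxSubmodule_of_forall fun ε hε => ?_
  obtain ⟨t, ht, htε⟩ : ∃ t : ℝ, 0 < t ∧ t * (‖w‖ * ‖w‖) < ε := by
    refine ⟨ε / (‖w‖ * ‖w‖ + 1), by positivity, ?_⟩
    rw [div_mul_eq_mul_div, div_lt_iff₀ (by positivity)]
    nlinarith [norm_nonneg w]
  obtain ⟨r, hr1, hr2, hr⟩ := exists_resolvent hws t
  have htI : (t * Complex.I : ℂ) ≠ 0 := by simp [ht.ne']
  have h1 : (t * Complex.I : ℂ)⁻¹ • (1 - r) = w * r := by
    rw [inv_smul_eq_iff₀ htI, ← hr2, add_mul, one_mul, add_sub_cancel_left, smul_mul_assoc]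
  refine ⟨w * r, ?_, ?_⟩
  · rw [← h1]
    exact Submodule.smul_mem _ _ (Submodule.sub_mem _ hone (hres t r hr1 hr2 hr))
  · have h2 : w * r - w = -((t * Complex.I : ℂ) • (w * (w * r))) := by
      have h3 : (t * Complex.I : ℂ) • (w * r) = 1 - r := by rw [← h1, smul_inv_smul₀ htI]
      rw [← mul_smul_comm, h3, mul_sub, mul_one, neg_sub]
    refine (hτ.norm2_le_norm _).trans_lt (lt_of_le_of_lt ?_ htε)
    rw [h2, norm_neg, norm_smul]
    have h3 : ‖(t * Complex.I : ℂ)‖ = t := by simp [abs_of_pos ht]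
    rw [h3]
    gcongr
    refine (norm_mul_le _ _).trans ?_
    gcongr
    exact (norm_mul_le _ _).trans (mul_le_of_le_one_right (norm_nonneg _) hr)

/-- A chain of von Neumann subalgebras of `N` has an upper bound which is approximated by the
members of the chain, namely the double commutant of the union. -/
theorem exists_upperBound_of_isChain (hτ : IsTrace N τ) {c : Set (SA N)}
    (hc : IsChain (· ≤ ·) c) (hne : c.Nonempty) {l : Filter (SA N)}
    (hl : ∀ P ∈ c, ∀ᶠ Q in l, P ≤ Q) :
    ∃ Q : SA N, (∀ P ∈ c, P ≤ Q) ∧ Q.toSet ⊆ approxSubmodule τ l := by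
  obtain ⟨P₀, hP₀⟩ := hne
  let A : StarSubalgebra ℂ (H →L[ℂ] H) :=
    { carrier := {x | ∃ P ∈ c, x ∈ P.1}
      mul_mem' := by
        rintro x y ⟨P, hP, hx⟩ ⟨Q, hQ, hy⟩
        rcases hc.total hP hQ with h | h
        · exact ⟨Q, hQ, mul_mem (h hx) hy⟩
        · exact ⟨P, hP, mul_mem hx (h hy)⟩
      add_mem' := by
        rintro x y ⟨P, hP, hx⟩ ⟨Q, hQ, hy⟩
        rcases hc.total hP hQ with h | h
        · exact ⟨Q, hQ, add_mem (h hx) hy⟩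
        · exact ⟨P, hP, add_mem hx (h hy)⟩
      algebraMap_mem' := fun z => ⟨P₀, hP₀, P₀.1.algebraMap_mem' z⟩
      star_mem' := by
        rintro x ⟨P, hP, hx⟩
        exact ⟨P, hP, star_mem hx⟩ }
  have hA : ∀ x, x ∈ A ↔ ∃ P ∈ c, x ∈ P.1 := fun x => Iff.rfl
  let Q : VonNeumannAlgebra H :=
    { toStarSubalgebra := StarSubalgebra.centralizer ℂ
        (StarSubalgebra.centralizer ℂ (A : Set (H →L[ℂ] H)) : Set (H →L[ℂ] H))
      centralizer_centralizer' := by simp }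
  have hQ : ∀ x, x ∈ Q ↔ x ∈ Set.centralizer (Set.centralizer (A : Set (H →L[ℂ] H))) := by
    intro x
    change x ∈ (StarSubalgebra.centralizer ℂ
      (StarSubalgebra.centralizer ℂ (A : Set (H →L[ℂ] H)) : Set (H →L[ℂ] H)) : Set (H →L[ℂ] H)) ↔ _
    rw [StarSubalgebra.coe_centralizer_centralizer, StarMemClass.star_coe_eq, Set.union_self]
  have hAN : (A : Set (H →L[ℂ] H)) ⊆ N := fun x hx => by
    obtain ⟨P, -, hx⟩ := (hA x).mp hx
    exact P.2 hx
  have hQN : Q ≤ N := fun x hx => by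
    have h1 := Set.centralizer_subset (Set.centralizer_subset hAN) ((hQ x).mp hx)
    rwa [N.centralizer_centralizer] at h1
  refine ⟨⟨Q, hQN⟩, fun P hP x hx => (hQ x).mpr (Set.subset_centralizer_centralizer ⟨P, hP, hx⟩),
    fun x hx => ?_⟩
  have hxQ : (x : H →L[ℂ] H) ∈ Q := hx
  have hre : ((realPart x : N) : H →L[ℂ] H) ∈ Q := by
    rw [realPart_apply_coe]
    exact SMulMemClass.smul_mem (s := Q) ((2⁻¹ : ℝ) : ℂ) (add_mem hxQ (star_mem hxQ))
  have him : ((imaginaryPart x : N) : H →L[ℂ] H) ∈ Q := by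
    rw [imaginaryPart_apply_coe]
    exact SMulMemClass.smul_mem (s := Q) (-Complex.I)
      (SMulMemClass.smul_mem (s := Q) ((2⁻¹ : ℝ) : ℂ) (sub_mem hxQ (star_mem hxQ)))
  rw [← realPart_add_I_smul_imaginaryPart x]
  exact add_mem
    (mem_approxSubmodule_of_isSelfAdjoint hτ hA hl ((hQ _).mp hre) (realPart x).2)
    (Submodule.smul_mem _ _
      (mem_approxSubmodule_of_isSelfAdjoint hτ hA hl ((hQ _).mp him) (imaginaryPart x).2))

theorem exists_maximal_HAP (hN : HasSeparablePredual N) (hτ : IsTrace N τ) {P : SA N}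
    (hP : P ∈ HAP N τ) : ∃ Q : SA N, P ≤ Q ∧ Maximal (fun R => R ∈ HAP N τ) Q := by
  refine zorn_le_nonempty₀ (HAP N τ) (fun c hcs hc R hR => ?_) P hP
  have : Nonempty c := ⟨⟨R, hR⟩⟩
  have : IsDirectedOrder c := ⟨fun a b => by
    rcases hc.total a.2 b.2 with h | h
    · exact ⟨b, h, le_rfl⟩
    · exact ⟨a, le_rfl, h⟩⟩
  obtain ⟨Q, hcQ, hQ⟩ := exists_upperBound_of_isChain hτ hc ⟨R, hR⟩
    (l := map (Subtype.val : c → SA N) atTop)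
    fun P hP => eventually_map.mpr (eventually_ge_atTop (⟨P, hP⟩ : c))
  exact ⟨Q, mem_HAP_of_approx hN hτ (eventually_map.mpr (Eventually.of_forall fun P => hcs P.2)) hQ,
    hcQ⟩

end Maximal

end HaagerupMax

theorem mainTheorem8 {H : Type*} [NormedAddCommGroup H] [InnerProductSpace ℂ H]
    [CompleteSpace H] (N : VonNeumannAlgebra H) (hN : HaagerupMax.HasSeparablePredual N)
    (τ : N →ₚ[ℂ] ℂ) (hτ : HaagerupMax.IsTrace N τ) :
    -- the inferior limit of a net of Haagerup subalgebras is Haagerup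
    (∀ (ι : Type*) [Preorder ι] [IsDirectedOrder ι] [Nonempty ι]
      (Mi : ι → HaagerupMax.SA N) (M : HaagerupMax.SA N),
      (∀ i, Mi i ∈ HaagerupMax.HAP N τ) →
      M.toSet = HaagerupMax.emLiminf τ Mi →
      M ∈ HaagerupMax.HAP N τ) ∧
    -- the set of Haagerup subalgebras is closed in the Effros–Maréchal topology
    IsClosed[HaagerupMax.effrosMarechal N] (HaagerupMax.HAP N τ) ∧
    -- the same in terms of nets `Mi` with `liminf Mi = limsup Mi = M`
    (∀ (ι : Type*) [Preorder ι] [IsDirectedOrder ι] [Nonempty ι]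
      (Mi : ι → HaagerupMax.SA N) (M : HaagerupMax.SA N),
      (∀ i, Mi i ∈ HaagerupMax.HAP N τ) →
      HaagerupMax.emLiminf τ Mi = M.toSet → HaagerupMax.emLimsup Mi = M.toSet →
      M ∈ HaagerupMax.HAP N τ) ∧
    -- every Haagerup subalgebra is contained in a maximal one
    (∀ P ∈ HaagerupMax.HAP N τ, ∃ Q : HaagerupMax.SA N,
      P ≤ Q ∧ Maximal (fun R => R ∈ HaagerupMax.HAP N τ) Q) := by
  refine ⟨fun ι _ _ _ Mi M hMi hM => ?_, HaagerupMax.isClosed_HAP hN hτ,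
    fun ι _ _ _ Mi M hMi hM _ => ?_, fun P hP => HaagerupMax.exists_maximal_HAP hN hτ hP⟩
  · exact HaagerupMax.mem_HAP_of_subset_emLiminf hN hτ hMi hM.subset
  · exact HaagerupMax.mem_HAP_of_subset_emLiminf hN hτ hMi hM.symm.subset
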